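/- For a $d$-regular simple graph $G$ on a finite vertex set $V$ let $A$ be its normalized adjacency matrix (entries $1/d$ at edges, $0$ elsewhere), $J$ the matrix with all entries $1/|V|$, and $\mu$ the uniform probability measure on $V$; call $G$ a $(d,\lambda)$-expander if $\|A-J\|_{L_2(\mu)\to L_2(\mu)}\le\lambda$. For $n\ge 1$, $k=\lfloor\sqrt n\rfloor$ and a graph $G$ with vertex set $\{-1,1\}^k$, let $D_n(G)\subseteq\{-1,1\}^n$ be the set of all $\varepsilon$ whose first $k^2$ coordinates are the concatenation $w_1w_2\cdots w_k$ of the vertices of a walk $w_1,\dots,w_k$ in $G$; the remaining $n-k^2\le 2k$ coordinates are arbitrary (if $n=k^2$, then $D_n(G)$ is exactly the set of concatenations of the labels of walks with $\sqrt n$ vertices). For real numbers $C_1,C$, say that a nonempty set $D\subseteq\{-1,1\}^n$ is good for $(C_1,C)$ if $|D|\le 2^{C_1\sqrt n}$ and, for $\varepsilon$ uniformly distributed on $D$, all real $v_1,\dots,v_n\ge 1$ and all $x_0\in\mathbb R$, $$\Pr\big[\,|\varepsilon_1v_1+\cdots+\varepsilon_nv_n-x_0|\le 1\,\big]\le \frac{C}{\sqrt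 n}.$$ Explicit graphs. For $k\ge1$ put $a=\max(0,\lfloor (k-5)/2\rfloor)$, $b=\max(0,\lfloor (k-4)/2\rfloor)$. Read a word $w\in\{-1,1\}^k$ in binary (letter $1$ is the digit $1$, letter $-1$ the digit $0$, least significant digit first, missing letters being $0$): its first $5$ letters give $t\in\mathbb Z/32$, the next $a$ letters $x\in\mathbb Z/2^a$, the next $b$ letters $y\in\mathbb Z/2^b$. The graph $G_k$ on $\{-1,1\}^k$ joins, for $1\le j\le 16$, distinct words standing for $(t,p)$ and $(t+j,s_j(p))$, where $s_1(x,y)=(x+2y,y)$, $s_2(x,y)=(x+2y+1,y)$, $s_3(x,y)=(x,y+2x)$, $s_4(x,y)=(x,y+2x+1)$ (with $x,y$ represented by their least non-negative residues) and $s_j$ is the identity for $j\ge 5$. Theorem. (a) There are universal constants $\lambda<1$, $C_1$, $C$ such that $G_k$ is a $(31,\lambda)$-expander for every $k\ge 5$, and for every $n\ge 1$ the explicit set $D_n(G_{\lfloor\sqrt n\rfloor})$ is good for $(C_1,C)$. (b) More generally, for every $d$ and every $\lambda<1$ there are constants $C_1$, $C$ such that for every $n\ge 1$ and every $(d,\lambda)$-expander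 $G$ with vertex set $\{-1,1\}^{\lfloor\sqrt n\rfloor}$ the set $D_n(G)$ is good for $(C_1,C)$. -/

import Mathlib

open Finset

/-- The normalized adjacency matrix `A / d` of a `d`-regular graph. -/
noncomputable def normAdj {V : Type*} [Fintype V] (G : SimpleGraph V) (d : ℕ) :
    Matrix V V ℝ :=
  open Classical in Matrix.of fun v w => if G.Adj v w then 1 / (d : ℝ) else 0

/-- The averaging matrix `J`, all of whose entries are `1 / |V|`. -/
noncomputable def avgMatrix (V : Type*) [Fintype V] : Matrix V V ℝ :=
  Matrix.of fun _ _ => 1 / (Fintype.card V : ℝ)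

/-- The norm of `L₂(μ)` for the uniform probability measure `μ` on `V`. -/
noncomputable def l2Norm {V : Type*} [Fintype V] (f : V → ℝ) : ℝ :=
  Real.sqrt (∑ v, f v ^ 2 * (1 / (Fintype.card V : ℝ)))

/-- `G` is `d`-regular and the operator norm of `A - J` on `L₂(μ)` is at most `lam`, where `A` is
the normalized adjacency matrix, `J` the averaging matrix and `μ` the uniform measure. -/
structure IsSpectralExpander {V : Type*} [Fintype V] (G : SimpleGraph V) (d : ℕ) (lam : ℝ) :
    Prop where
  regular : ∀ v, {w | G.Adj v w}.ncard = d
  norm_le : ∀ f : V → ℝ,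
    l2Norm (Matrix.mulVec (normAdj G d - avgMatrix V) f) ≤ lam * l2Norm f

/-- The sign vectors `ε ∈ {-1,1}ⁿ` (with `ℤˣ = {-1,1}`) whose first `k²` coordinates,
`k = ⌊√n⌋`, are the concatenation of the labels of a walk with `k` vertices in the graph `G` with
vertex set `{-1,1}ᵏ`; the at most `2k` last coordinates, which exist only if `n` is not a square,
are arbitrary. -/
noncomputable def walkSet (n : ℕ) (G : SimpleGraph (Fin n.sqrt → ℤˣ)) : Finset (Fin n → ℤˣ) :=
  open Classical in
  univ.filter fun ε => ∃ (u v : Fin n.sqrt → ℤˣ) (p : G.Walk u v), p.length + 1 = n.sqrt ∧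
    ∀ (j : ℕ) (l : Fin n.sqrt) (i : Fin n), j < n.sqrt → (i : ℕ) = j * n.sqrt + l →
      ε i = p.getVert j l

/-- The probability, for `ε` uniform on `D`, that `|ε₁v₁ + ⋯ + εₙvₙ - x₀| ≤ 1`. -/
noncomputable def smallBallProb {n : ℕ} (D : Finset (Fin n → ℤˣ)) (v : Fin n → ℝ) (x₀ : ℝ) : ℝ :=
  ((D.filter fun ε => |∑ i, ((ε i : ℤ) : ℝ) * v i - x₀| ≤ 1).card : ℝ) / (D.card : ℝ)

/-- `D ⊆ {-1,1}ⁿ` is a nonempty set with at most `2 ^ (C₁ √n)` elements, the uniform measure on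
which satisfies the Littlewood–Offord bound with constant `C`. -/
structure IsLittlewoodOffordSet (C₁ C : ℝ) {n : ℕ} (D : Finset (Fin n → ℤˣ)) : Prop where
  nonempty : D.Nonempty
  card_le : (D.card : ℝ) ≤ (2 : ℝ) ^ (C₁ * Real.sqrt n)
  prob_le : ∀ v : Fin n → ℝ, (∀ i, 1 ≤ v i) → ∀ x₀ : ℝ,
    smallBallProb D v x₀ ≤ C / Real.sqrt n

/-- The integer modulo `2ᵐ` whose binary digits (least significant first) are the coordinates
`s, …, s + m - 1` of the word `w`; the letter `1` is the digit `1`, the letter `-1` the digit `0`,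
and missing coordinates are read as `0`. -/
def wordBits {k : ℕ} (w : Fin k → ℤˣ) (s m : ℕ) : ZMod (2 ^ m) :=
  ∑ i : Fin k, if s ≤ (i : ℕ) ∧ (i : ℕ) < s + m ∧ w i = 1 then 2 ^ ((i : ℕ) - s) else 0

/-- The four shears of the Gabber–Galil graph, on `ℤ/2ᵃ × ℤ/2ᵇ` (used for `a ≤ b ≤ a + 1`), as the
moves `1, 2, 3, 4`; every other move is the identity. -/
def shear (a b : ℕ) : ℕ → ZMod (2 ^ a) × ZMod (2 ^ b) → ZMod (2 ^ a) × ZMod (2 ^ b)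
  | 1, (x, y) => (x + 2 * (y.val : ZMod (2 ^ a)), y)
  | 2, (x, y) => (x + 2 * (y.val : ZMod (2 ^ a)) + 1, y)
  | 3, (x, y) => (x, y + 2 * (x.val : ZMod (2 ^ b)))
  | 4, (x, y) => (x, y + 2 * (x.val : ZMod (2 ^ b)) + 1)
  | _, p => p

/-- The point `(x, y)` of `ℤ/2ᵃ × ℤ/2ᵇ`, `a = ⌊(k-5)/2⌋`, `b = ⌊(k-4)/2⌋`, that is written in a
word of length `k` after its first five letters. -/
def wordPoint {k : ℕ} (w : Fin k → ℤˣ) :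
    ZMod (2 ^ ((k - 5) / 2)) × ZMod (2 ^ ((k - 4) / 2)) :=
  (wordBits w 5 ((k - 5) / 2), wordBits w (5 + (k - 5) / 2) ((k - 4) / 2))

/-- The explicit graph on `{-1,1}ᵏ`. A word stands for a triple `(t, x, y)` in
`ℤ/32 × ℤ/2ᵃ × ℤ/2ᵇ`, and for `1 ≤ j ≤ 16` the triple `(t, p)` is joined to `(t + j, shear j p)`.
(Each of the `31` other values of the first entry occurs at exactly one neighbour, so parallel
edges do not arise.) -/
def explicitGraph (k : ℕ) : SimpleGraph (Fin k → ℤˣ) :=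
  SimpleGraph.fromRel fun w w' => ∃ j : ℕ, 1 ≤ j ∧ j ≤ 16 ∧
    wordBits w' 0 5 = wordBits w 0 5 + (j : ZMod (2 ^ 5)) ∧
    wordPoint w' = shear ((k - 5) / 2) ((k - 4) / 2) j (wordPoint w)

/-- The explicit subset of `{-1,1}ⁿ`: walks on the explicit graph with vertex set `{-1,1}ᵏ`,
`k = ⌊√n⌋`. -/
noncomputable def explicitSet (n : ℕ) : Finset (Fin n → ℤˣ) :=
  walkSet n (explicitGraph n.sqrt)

/-! Littlewood–Offord bound. By Esseen's inequality it suffices to bound the integral over unit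
intervals of the modulus of the characteristic function, that is, of the mean over walks of `∏ⱼ
Uⱼ(wⱼ)` with phases `Uⱼ(w) = exp(iτ ∑ₗ wₗ vⱼₗ)`. Over a uniform word, `Uⱼ` has mean `∏ₗ cos(τ vⱼₗ)`.
On an expander, two steps with a phase of mean `u` in between multiply the squared L₂ norm by at
most `1 - (1 - λ²)²(1 - |u|²)` (`sum_norm_sq_matVec_mul_matVec_le`): the steps shrink the part of
mean zero, and the phase moves weight from the constant part into it. So the characteristic function
decays exponentially in `∑ⱼ min(∑ₗ sin²(τ vⱼₗ), 1)`. Jensen's inequality, used over `j` and then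
over `l`, turns this into `exp(-c√n)` plus an average over the coordinates of `exp(-c n sin²(τ
vⱼₗ))` (`norm_meanValue_walkVec_phase_le`). Since `vⱼₗ ≥ 1`, the argument of the sine
equidistributes enough for each such term to have integral `O(1/√n)`. The walk has about `√n`
vertices of `√n` letters each, so it carries only `O(√n)` bits.

Explicit expander. On the torus `ℤ/2ᵃ × ℤ/2ᵇ` the Fourier transform turns shears into dual shears of
the characters. A shear and its inverse send the flat double sector near the trivial character to
disjoint parts of the steep one, and another shear does the converse. A function almost invariant
under both shears would thus have in each sector nearly twice the weight of the other, unless its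
weight lies far from the trivial character, where translations detect it
(`sum_norm_sq_le_of_shears`). The factor `ℤ/32` makes the graph simple and regular: each nonzero
difference of first coordinates determines one neighbour. Comparing the moves 5 and 6, both trivial
on the torus, gives the variation along `ℤ/32`; comparing the shears with move 5 gives the variation
on the torus. All these differences are the defect in Cauchy–Schwarz for the sum over the 31
neighbours, which yields the gap. -/

/-! ### Fourier analysis and the Gabber–Galil inequality -/

section Poincare

variable {G : Type*} [AddCommGroup G]

/-- The action of an automorphism of `G` on the characters of `G`. -/
noncomputable def charPerm (S : G ≃+ G) : Equiv.Perm (AddChar G ℂ) where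
  toFun ψ := ψ.compAddMonoidHom S.toAddMonoidHom
  invFun ψ := ψ.compAddMonoidHom S.symm.toAddMonoidHom
  left_inv ψ := by ext x; simp
  right_inv ψ := by ext x; simp

theorem charPerm_apply (S : G ≃+ G) (ψ : AddChar G ℂ) (p : G) : charPerm S ψ p = ψ (S p) := rfl

theorem charPerm_symm_apply (S : G ≃+ G) (ψ : AddChar G ℂ) (p : G) :
    (charPerm S).symm ψ p = ψ (S.symm p) := rfl

variable [Fintype G]

/-- The Fourier coefficient of `g` at the character `ψ`. -/
noncomputable def fourierCoeffAt (g : G → ℂ) (ψ : AddChar G ℂ) : ℂ :=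
  ∑ p, g p * ψ (-p)

/-- Parseval: expand the square and sum over characters first, which leaves only the diagonal. -/
theorem sum_norm_sq_fourierCoeffAt (g : G → ℂ) :
    ∑ ψ : AddChar G ℂ, ‖fourierCoeffAt g ψ‖ ^ 2 = Fintype.card G * ∑ p, ‖g p‖ ^ 2 := by
  classical
  have h : ∀ ψ : AddChar G ℂ, ((‖fourierCoeffAt g ψ‖ ^ 2 : ℝ) : ℂ) =
      ∑ p, ∑ q, g p * (starRingEnd ℂ) (g q) * ψ (q - p) := by
    intro ψ
    rw [Complex.ofReal_pow, ← Complex.mul_conj', fourierCoeffAt, map_sum, Finset.sum_mul_sum]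
    refine Finset.sum_congr rfl fun p _ => Finset.sum_congr rfl fun q _ => ?_
    rw [map_mul, ← AddChar.map_neg_eq_conj, neg_neg, sub_eq_add_neg, AddChar.map_add_eq_mul]
    ring
  have h2 : ((∑ ψ : AddChar G ℂ, ‖fourierCoeffAt g ψ‖ ^ 2 : ℝ) : ℂ) =
      ((Fintype.card G * ∑ p, ‖g p‖ ^ 2 : ℝ) : ℂ) := by
    rw [Complex.ofReal_sum, Finset.sum_congr rfl fun ψ _ => h ψ, Finset.sum_comm]
    push_cast
    rw [Finset.mul_sum]
    refine Finset.sum_congr rfl fun p _ => ?_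
    rw [Finset.sum_comm]
    simp_rw [← Finset.mul_sum, AddChar.sum_apply_eq_ite, sub_eq_zero]
    simp [Complex.mul_conj', mul_comm]
  exact_mod_cast h2

theorem fourierCoeffAt_sub (g h : G → ℂ) (ψ : AddChar G ℂ) :
    fourierCoeffAt (fun p => g p - h p) ψ = fourierCoeffAt g ψ - fourierCoeffAt h ψ := by
  simp [fourierCoeffAt, sub_mul]

theorem fourierCoeffAt_translate (g : G → ℂ) (e : G) (ψ : AddChar G ℂ) :
    fourierCoeffAt (fun p => g (p + e)) ψ = ψ e * fourierCoeffAt g ψ := by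
  rw [fourierCoeffAt, fourierCoeffAt, Finset.mul_sum, ← Equiv.sum_comp (Equiv.addRight e)
    (fun p => ψ e * (g p * ψ (-p)))]
  refine Finset.sum_congr rfl fun p _ => ?_
  have : ψ (-p) = ψ e * ψ (-(p + e)) := by
    rw [← AddChar.map_add_eq_mul]; congr 1; abel
  simp only [Equiv.coe_addRight]
  rw [this]; ring

theorem fourierCoeffAt_charPerm (g : G → ℂ) (S : G ≃+ G) (ψ : AddChar G ℂ) :
    fourierCoeffAt g (charPerm S ψ) = fourierCoeffAt (fun p => g (S.symm p)) ψ := by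
  rw [fourierCoeffAt, fourierCoeffAt, ← Equiv.sum_comp S.symm.toEquiv]
  refine Finset.sum_congr rfl fun p _ => ?_
  simp [charPerm_apply]

/-- An automorphism acts on the Fourier transform by permuting characters, so Parseval carries the
variation along `S` to the dual side. -/
theorem sum_norm_sq_fourierCoeffAt_charPerm_sub (g : G → ℂ) (S : G ≃+ G) :
    ∑ ψ, ‖fourierCoeffAt g (charPerm S ψ) - fourierCoeffAt g ψ‖ ^ 2 =
      Fintype.card G * ∑ p, ‖g (S p) - g p‖ ^ 2 := by
  simp_rw [fourierCoeffAt_charPerm, ← fourierCoeffAt_sub, sum_norm_sq_fourierCoeffAt]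
  congr 1
  rw [← Equiv.sum_comp S.toEquiv]
  refine Finset.sum_congr rfl fun p _ => ?_
  simp [norm_sub_rev]

theorem sum_norm_sq_sub_one_mul_fourierCoeffAt (g : G → ℂ) (e : G) :
    ∑ ψ : AddChar G ℂ, ‖ψ e - 1‖ ^ 2 * ‖fourierCoeffAt g ψ‖ ^ 2 =
      Fintype.card G * ∑ p, ‖g (p + e) - g p‖ ^ 2 := by
  rw [← sum_norm_sq_fourierCoeffAt]
  refine Finset.sum_congr rfl fun ψ _ => ?_
  rw [fourierCoeffAt_sub, fourierCoeffAt_translate, ← mul_pow, ← norm_mul, sub_mul, one_mul]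

/-- Triangle inequality and weighted AM–GM. The factor must exceed `1/2`, so that two disjoint
images of a set together outweigh it. -/
theorem norm_sq_ge_of_near (a b : ℂ) : 3 / 4 * ‖a‖ ^ 2 - 3 * ‖b - a‖ ^ 2 ≤ ‖b‖ ^ 2 := by
  have h : ‖a‖ ≤ ‖b‖ + ‖b - a‖ := by
    calc ‖a‖ = ‖b - (b - a)‖ := by ring_nf
      _ ≤ _ := norm_sub_le _ _
  have := norm_nonneg a
  nlinarith [sq_nonneg (‖b‖ - 3 * ‖b - a‖), norm_nonneg b, norm_nonneg (b - a)]

/-- If a permutation and its inverse map `B` to disjoint subsets of `P`, and nearly preserve the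
weight `‖h‖²`, then `P` weighs nearly twice as much as `B`. -/
theorem sum_le_sum_of_perm_disjoint {ι : Type*} [Fintype ι] (h : ι → ℂ) (T : Equiv.Perm ι)
    (B P : Finset ι) (h1 : ∀ x ∈ B, T x ∈ P) (h2 : ∀ x ∈ B, T.symm x ∈ P)
    (h3 : ∀ x ∈ B, ∀ y ∈ B, T x ≠ T.symm y) :
    3 / 2 * ∑ x ∈ B, ‖h x‖ ^ 2 ≤ ∑ x ∈ P, ‖h x‖ ^ 2 + 6 * ∑ x, ‖h (T x) - h x‖ ^ 2 := by
  classical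
  have k1 : ∀ (U : Equiv.Perm ι), ∑ x, ‖h (U x) - h x‖ ^ 2 = ∑ x, ‖h (T x) - h x‖ ^ 2 →
      3 / 4 * ∑ x ∈ B, ‖h x‖ ^ 2 - 3 * ∑ x, ‖h (T x) - h x‖ ^ 2 ≤ ∑ x ∈ B, ‖h (U x)‖ ^ 2 := by
    intro U hU
    rw [← hU]
    have : ∑ x ∈ B, ‖h (U x) - h x‖ ^ 2 ≤ ∑ x, ‖h (U x) - h x‖ ^ 2 :=
      Finset.sum_le_sum_of_subset_of_nonneg (Finset.subset_univ _) fun _ _ _ => by positivity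
    have h4 := Finset.sum_le_sum fun x (_ : x ∈ B) => norm_sq_ge_of_near (h x) (h (U x))
    rw [Finset.sum_sub_distrib, ← Finset.mul_sum, ← Finset.mul_sum] at h4
    linarith
  have e1 := k1 T rfl
  have e2 := k1 T.symm (by
    rw [← Equiv.sum_comp T]
    refine Finset.sum_congr rfl fun x _ => ?_
    rw [Equiv.symm_apply_apply, norm_sub_rev])
  have e3 : ∑ x ∈ B, ‖h (T x)‖ ^ 2 + ∑ x ∈ B, ‖h (T.symm x)‖ ^ 2 ≤ ∑ x ∈ P, ‖h x‖ ^ 2 := by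
    rw [← Finset.sum_image (s := B) (g := T) (f := fun x => ‖h x‖ ^ 2)
      (fun _ _ _ _ e => T.injective e), ← Finset.sum_image (s := B) (g := T.symm)
      (f := fun x => ‖h x‖ ^ 2) (fun _ _ _ _ e => T.symm.injective e), ← Finset.sum_union]
    · refine Finset.sum_le_sum_of_subset_of_nonneg ?_ fun _ _ _ => by positivity
      intro x hx
      simp only [Finset.mem_union, Finset.mem_image] at hx
      rcases hx with ⟨y, hy, rfl⟩ | ⟨y, hy, rfl⟩
      · exact h1 y hy
      · exact h2 y hy
    · rw [Finset.disjoint_left]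
      intro x hx hx'
      simp only [Finset.mem_image] at hx hx'
      obtain ⟨y, hy, rfl⟩ := hx
      obtain ⟨z, hz, e⟩ := hx'
      exact h3 y hy z hz e.symm
  linarith

/-- The half-open double sector of slopes in `(-1, 1]`. -/
def flatSector (s t : ℝ) : Prop := (0 < s ∧ -s < t ∧ t ≤ s) ∨ (s < 0 ∧ s ≤ t ∧ t < -s)

/-- The complement of `flatSector` in the punctured plane. -/
def steepSector (s t : ℝ) : Prop := (0 < t ∧ -t ≤ s ∧ s < t) ∨ (t < 0 ∧ t < s ∧ s ≤ -t)

theorem flatSector_or_steepSector {s t : ℝ} (h : ¬(s = 0 ∧ t = 0)) :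
    flatSector s t ∨ steepSector s t := by
  unfold flatSector steepSector
  by_contra! hc
  apply h
  grind

theorem not_flatSector_of_steepSector {s t : ℝ} (h : steepSector s t) : ¬flatSector s t := by
  unfold flatSector steepSector at *
  grind

/-- Below `π/3`, the angle `arg w ± 2 arg z` stays inside `(-π, π)`, so arguments add without
wrapping. -/
theorem arg_mul_sq {z w : ℂ} (hz : z ≠ 0) (hw : w ≠ 0) (h1 : |z.arg| < Real.pi / 3)
    (h2 : |w.arg| < Real.pi / 3) :
    (w * (z * z)).arg = w.arg + 2 * z.arg ∧ (w * (z⁻¹ * z⁻¹)).arg = w.arg - 2 * z.arg := by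
  rw [abs_lt] at h1 h2
  have hpi := Real.pi_pos
  have hi : z⁻¹.arg = -z.arg := by
    rw [Complex.arg_inv, if_neg]
    intro h; rw [h] at h1; linarith
  have hz' := inv_ne_zero hz
  have a1 : (z * z).arg = z.arg + z.arg :=
    Complex.arg_mul hz hz ⟨by linarith, by linarith⟩
  have a2 : (z⁻¹ * z⁻¹).arg = z⁻¹.arg + z⁻¹.arg :=
    Complex.arg_mul hz' hz' (by rw [hi]; exact ⟨by linarith, by linarith⟩)
  constructor
  · rw [Complex.arg_mul hw (mul_ne_zero hz hz) (by rw [a1]; exact ⟨by linarith, by linarith⟩), a1]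
    ring
  · rw [Complex.arg_mul hw (mul_ne_zero hz' hz')
      (by rw [a2, hi]; exact ⟨by linarith, by linarith⟩), a2, hi]
    ring

/-- The real part is at most `cos(π/3) = 1/2`, and `‖z - 1‖² = 2 - 2 re z` on the unit circle. -/
theorem one_le_norm_sub_one_sq {z : ℂ} (hz : ‖z‖ = 1) (h : Real.pi / 3 ≤ |z.arg|) :
    1 ≤ ‖z - 1‖ ^ 2 := by
  have h1 : z.re ≤ 1 / 2 := by
    have : Real.cos z.arg = z.re := by
      rw [Complex.cos_arg (by intro h0; simp [h0] at hz), hz, div_one]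
    rw [← this, ← Real.cos_abs, ← Real.cos_pi_div_three]
    exact Real.cos_le_cos_of_nonneg_of_le_pi (by positivity) (Complex.abs_arg_le_pi z) h
  have h2 : ‖z‖ ^ 2 = 1 := by rw [hz]; norm_num
  rw [← Complex.normSq_eq_norm_sq, Complex.normSq_apply] at h2 ⊢
  simp only [Complex.sub_re, Complex.sub_im, Complex.one_re, Complex.one_im]
  nlinarith

theorem ne_zero_addChar (ψ : AddChar G ℂ) (p : G) : ψ p ≠ 0 := by
  intro h
  have := ψ.norm_apply p
  simp [h] at this

/-- The Gabber–Galil spectral gap, as a Poincaré inequality, for complex-valued functions. -/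
theorem sum_norm_sq_le_of_shears (S₁ S₃ : G ≃+ G) (e₁ e₂ : G)
    (h11 : S₁ e₁ = e₁) (h12 : S₁ e₂ = e₂ + (e₁ + e₁)) (h32 : S₃ e₂ = e₂)
    (h31 : S₃ e₁ = e₁ + (e₂ + e₂))
    (hgen : ∀ ψ : AddChar G ℂ, ψ e₁ = 1 → ψ e₂ = 1 → ψ = 0)
    (g : G → ℂ) (hg : ∑ p, g p = 0) :
    ∑ p, ‖g p‖ ^ 2 ≤ 12 * (∑ p, ‖g (S₁ p) - g p‖ ^ 2 + ∑ p, ‖g (S₃ p) - g p‖ ^ 2) +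
      3 * (∑ p, ‖g (p + e₁) - g p‖ ^ 2 + ∑ p, ‖g (p + e₂) - g p‖ ^ 2) := by
  classical
  set F : AddChar G ℂ → ℂ := fourierCoeffAt g with hF
  set Q : Finset (AddChar G ℂ) := univ.filter fun ψ => flatSector (ψ e₁).arg (ψ e₂).arg with hQ
  set P : Finset (AddChar G ℂ) := univ.filter fun ψ => steepSector (ψ e₁).arg (ψ e₂).arg with hP
  let near : AddChar G ℂ → Prop := fun ψ =>
    |(ψ e₁).arg| < Real.pi / 3 ∧ |(ψ e₂).arg| < Real.pi / 3
  have i11 : S₁.symm e₁ = e₁ := by rw [AddEquiv.symm_apply_eq, h11]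
  have i12 : S₁.symm e₂ = e₂ + (-e₁ + -e₁) := by
    rw [AddEquiv.symm_apply_eq, map_add, map_add, map_neg, h11, h12]; abel
  have i32 : S₃.symm e₂ = e₂ := by rw [AddEquiv.symm_apply_eq, h32]
  have i31 : S₃.symm e₁ = e₁ + (-e₂ + -e₂) := by
    rw [AddEquiv.symm_apply_eq, map_add, map_add, map_neg, h32, h31]; abel
  have nz := fun (ψ : AddChar G ℂ) p => ne_zero_addChar ψ p
  have A1 : ∀ ψ, near ψ → (ψ (S₁ e₂)).arg = (ψ e₂).arg + 2 * (ψ e₁).arg ∧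
      (ψ (S₁.symm e₂)).arg = (ψ e₂).arg - 2 * (ψ e₁).arg := by
    intro ψ hn
    have := arg_mul_sq (nz ψ e₁) (nz ψ e₂) hn.1 hn.2
    simpa [h12, i12, AddChar.map_add_eq_mul, AddChar.map_neg_eq_inv] using this
  have A3 : ∀ ψ, near ψ → (ψ (S₃ e₁)).arg = (ψ e₁).arg + 2 * (ψ e₂).arg ∧
      (ψ (S₃.symm e₁)).arg = (ψ e₁).arg - 2 * (ψ e₂).arg := by
    intro ψ hn
    have := arg_mul_sq (nz ψ e₂) (nz ψ e₁) hn.2 hn.1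
    simpa [h31, i31, AddChar.map_add_eq_mul, AddChar.map_neg_eq_inv] using this
  -- The dual shear adds `±2` to the slope `t/s`: `(-1, 1]` goes to `(1, 3]` or `(-3, -1]`. These
  -- are disjoint and steep; the half-open ends are chosen to fit. For `B3` the roles of `s` and `t`
  -- are exchanged.
  have B1 : 3 / 2 * ∑ x ∈ Q.filter near, ‖F x‖ ^ 2 ≤
      ∑ x ∈ P, ‖F x‖ ^ 2 + 6 * ∑ x, ‖F (charPerm S₁ x) - F x‖ ^ 2 := by
    apply sum_le_sum_of_perm_disjoint
    · intro ψ hψ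
      simp only [hQ, hP, mem_filter, mem_univ, true_and, charPerm_apply, h11] at hψ ⊢
      rw [(A1 ψ hψ.2).1]
      have := hψ.1
      unfold flatSector at this; unfold steepSector
      grind
    · intro ψ hψ
      simp only [hQ, hP, mem_filter, mem_univ, true_and, charPerm_symm_apply, i11] at hψ ⊢
      rw [(A1 ψ hψ.2).2]
      have := hψ.1
      unfold flatSector at this; unfold steepSector
      grind
    · intro ψ hψ χ hχ he
      have u1 := congrArg (fun ω : AddChar G ℂ => (ω e₁).arg) he
      have u2 := congrArg (fun ω : AddChar G ℂ => (ω e₂).arg) he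
      simp only [hQ, mem_filter, mem_univ, true_and] at hψ hχ
      simp only [charPerm_apply, charPerm_symm_apply, i11, h11, (A1 ψ hψ.2).1, (A1 χ hχ.2).2]
        at u1 u2
      have v1 := hψ.1
      have v2 := hχ.1
      unfold flatSector at v1 v2
      grind
  have B3 : 3 / 2 * ∑ x ∈ P.filter near, ‖F x‖ ^ 2 ≤
      ∑ x ∈ Q, ‖F x‖ ^ 2 + 6 * ∑ x, ‖F (charPerm S₃ x) - F x‖ ^ 2 := by
    apply sum_le_sum_of_perm_disjoint
    · intro ψ hψ
      simp only [hQ, hP, mem_filter, mem_univ, true_and, charPerm_apply, h32] at hψ ⊢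
      rw [(A3 ψ hψ.2).1]
      have := hψ.1
      unfold steepSector at this; unfold flatSector
      grind
    · intro ψ hψ
      simp only [hQ, hP, mem_filter, mem_univ, true_and, charPerm_symm_apply, i32] at hψ ⊢
      rw [(A3 ψ hψ.2).2]
      have := hψ.1
      unfold steepSector at this; unfold flatSector
      grind
    · intro ψ hψ χ hχ he
      have u1 := congrArg (fun ω : AddChar G ℂ => (ω e₁).arg) he
      have u2 := congrArg (fun ω : AddChar G ℂ => (ω e₂).arg) he
      simp only [hP, mem_filter, mem_univ, true_and] at hψ hχ
      simp only [charPerm_apply, charPerm_symm_apply, i32, h32, (A3 ψ hψ.2).1, (A3 χ hχ.2).2]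
        at u1 u2
      have v1 := hψ.1
      have v2 := hχ.1
      unfold steepSector at v1 v2
      grind
  have hdisj : Disjoint Q P := by
    rw [Finset.disjoint_left]
    intro ψ h1 h2
    simp only [hQ, hP, mem_filter, mem_univ, true_and] at h1 h2
    exact not_flatSector_of_steepSector h2 h1
  have hF0 : F 0 = 0 := by simp [hF, fourierCoeffAt, hg]
  -- The sectors miss only the trivial character, whose coefficient is the sum of `g`, hence zero.
  have htot : ∑ x, ‖F x‖ ^ 2 = ∑ x ∈ Q, ‖F x‖ ^ 2 + ∑ x ∈ P, ‖F x‖ ^ 2 := by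
    rw [← Finset.sum_union hdisj]
    symm
    apply Finset.sum_subset (Finset.subset_univ _)
    intro ψ _ hψ
    have : ψ = 0 := by
      by_contra hne
      apply hψ
      simp only [hQ, hP, mem_union, mem_filter, mem_univ, true_and]
      apply flatSector_or_steepSector
      rintro ⟨a1, a2⟩
      apply hne
      have key : ∀ z : ℂ, ‖z‖ = 1 → z.arg = 0 → z = 1 := by
        intro z hz ha
        rw [← Complex.norm_mul_exp_arg_mul_I z, hz, ha]; simp
      exact hgen ψ (key _ (ψ.norm_apply _) a1) (key _ (ψ.norm_apply _) a2)
    rw [this, hF0]; simp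
  have hfar : ∑ x ∈ univ.filter (fun ψ => ¬near ψ), ‖F x‖ ^ 2 ≤
      ∑ ψ : AddChar G ℂ, ‖ψ e₁ - 1‖ ^ 2 * ‖F ψ‖ ^ 2 +
        ∑ ψ : AddChar G ℂ, ‖ψ e₂ - 1‖ ^ 2 * ‖F ψ‖ ^ 2 := by
    rw [← Finset.sum_add_distrib]
    refine (Finset.sum_le_sum fun ψ hψ => ?_).trans
      (Finset.sum_le_sum_of_subset_of_nonneg (Finset.subset_univ _) fun _ _ _ => by positivity)
    rw [← add_mul]
    apply le_mul_of_one_le_left (by positivity)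
    simp only [near, mem_filter, mem_univ, true_and, not_and_or, not_lt] at hψ
    rcases hψ with h | h
    · linarith [one_le_norm_sub_one_sq (ψ.norm_apply _) h, sq_nonneg ‖ψ e₂ - 1‖]
    · linarith [one_le_norm_sub_one_sq (ψ.norm_apply _) h, sq_nonneg ‖ψ e₁ - 1‖]
  have hsplitQ := Finset.sum_filter_add_sum_filter_not Q near (fun x => ‖F x‖ ^ 2)
  have hsplitP := Finset.sum_filter_add_sum_filter_not P near (fun x => ‖F x‖ ^ 2)
  have hfar2 : ∑ x ∈ Q.filter (fun ψ => ¬near ψ), ‖F x‖ ^ 2 +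
      ∑ x ∈ P.filter (fun ψ => ¬near ψ), ‖F x‖ ^ 2 ≤
      ∑ x ∈ univ.filter (fun ψ => ¬near ψ), ‖F x‖ ^ 2 := by
    rw [← Finset.sum_union (Finset.disjoint_filter_filter hdisj), ← Finset.filter_union]
    exact Finset.sum_le_sum_of_subset_of_nonneg
      (Finset.filter_subset_filter _ (Finset.subset_univ _)) fun _ _ _ => by positivity
  rw [sum_norm_sq_sub_one_mul_fourierCoeffAt, sum_norm_sq_sub_one_mul_fourierCoeffAt] at hfar
  rw [sum_norm_sq_fourierCoeffAt_charPerm_sub] at B1 B3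
  rw [sum_norm_sq_fourierCoeffAt] at htot
  have hN : (0 : ℝ) < Fintype.card G := by exact_mod_cast Fintype.card_pos
  refine le_of_mul_le_mul_left ?_ hN
  -- Adding `B1` and `B3` gives `3/2 (total - far) ≤ total + 6 (variations)`; hence the constants 12
  -- and 3.
  linarith

/-- The Gabber–Galil spectral gap, as a Poincaré inequality. -/
theorem sum_sq_le_of_shears (S₁ S₃ : G ≃+ G) (e₁ e₂ : G)
    (h11 : S₁ e₁ = e₁) (h12 : S₁ e₂ = e₂ + (e₁ + e₁)) (h32 : S₃ e₂ = e₂)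
    (h31 : S₃ e₁ = e₁ + (e₂ + e₂))
    (hgen : ∀ ψ : AddChar G ℂ, ψ e₁ = 1 → ψ e₂ = 1 → ψ = 0)
    (f : G → ℝ) (hf : ∑ p, f p = 0) :
    ∑ p, f p ^ 2 ≤ 18 * (∑ p, (f (S₁ p) - f p) ^ 2 + ∑ p, (f (S₁ p + e₁) - f p) ^ 2 +
      ∑ p, (f (S₃ p) - f p) ^ 2 + ∑ p, (f (S₃ p + e₂) - f p) ^ 2) := by
  have h := sum_norm_sq_le_of_shears S₁ S₃ e₁ e₂ h11 h12 h32 h31 hgen (fun p => (f p : ℂ))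
    (by exact_mod_cast hf)
  simp only [← Complex.ofReal_sub, Complex.norm_real, Real.norm_eq_abs, sq_abs] at h
  -- Replacing `p` by `S p` writes a translation difference as the difference of the two variations
  -- with and without `e`, so affine shears can stand in for translations.
  have t : ∀ (S : G ≃+ G) (e : G), ∑ p, (f (p + e) - f p) ^ 2 ≤
      2 * (∑ p, (f (S p + e) - f p) ^ 2 + ∑ p, (f (S p) - f p) ^ 2) := by
    intro S e
    rw [← Equiv.sum_comp S.toEquiv, ← Finset.sum_add_distrib, Finset.mul_sum]
    refine Finset.sum_le_sum fun p _ => ?_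
    simp only [AddEquiv.toEquiv_eq_coe, AddEquiv.coe_toEquiv]
    nlinarith [sq_nonneg (f (S p + e) - f p + (f (S p) - f p))]
  have t1 := t S₁ e₁
  have t3 := t S₃ e₂
  have p1 : 0 ≤ ∑ p, (f (S₁ p + e₁) - f p) ^ 2 := Finset.sum_nonneg fun _ _ => sq_nonneg _
  have p3 : 0 ≤ ∑ p, (f (S₃ p + e₂) - f p) ^ 2 := Finset.sum_nonneg fun _ _ => sq_nonneg _
  linarith

end Poincare

/-! ### From the torus to the 31-regular graph over `ℤ/32` -/

section Tower

/-- Lagrange's identity: the defect in Cauchy–Schwarz is the sum of squared differences. -/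
theorem sq_sum_eq_card_mul_sub {ι : Type*} (s : Finset ι) (a : ι → ℝ) :
    (∑ i ∈ s, a i) ^ 2 =
      s.card * ∑ i ∈ s, a i ^ 2 - 1 / 2 * ∑ i ∈ s, ∑ j ∈ s, (a i - a j) ^ 2 := by
  have h : ∑ i ∈ s, ∑ j ∈ s, (a i - a j) ^ 2 =
      2 * (s.card * ∑ i ∈ s, a i ^ 2) - 2 * (∑ i ∈ s, a i) ^ 2 := by
    have : ∀ i j, (a i - a j) ^ 2 = a i ^ 2 + a j ^ 2 - 2 * (a i * a j) := fun i j => by ring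
    simp_rw [this, Finset.sum_sub_distrib, Finset.sum_add_distrib, ← Finset.mul_sum,
      Finset.sum_const, ← Finset.sum_mul, nsmul_eq_mul, ← Finset.mul_sum]
    ring
  rw [h]; ring

variable {P : Type*} [Fintype P]

theorem sum_shift_fst (f : ZMod 32 × P → ℝ) (δ : ZMod 32) :
    ∑ v : ZMod 32 × P, f (v.1 + δ, v.2) = ∑ v, f v :=
  Equiv.sum_comp ((Equiv.addRight δ).prodCongr (Equiv.refl P)) f

/-- Telescope into `j` unit shifts and apply Cauchy–Schwarz; shift invariance makes all of them
contribute equally. -/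
theorem sum_sq_shift_sub_le (f : ZMod 32 × P → ℝ) (j : ℕ) :
    ∑ v : ZMod 32 × P, (f (v.1 + j, v.2) - f v) ^ 2 ≤
      j ^ 2 * ∑ v : ZMod 32 × P, (f (v.1 + 1, v.2) - f v) ^ 2 := by
  have h : ∀ v : ZMod 32 × P, (f (v.1 + j, v.2) - f v) ^ 2 ≤
      j * ∑ i ∈ range j, (f (v.1 + i + 1, v.2) - f (v.1 + i, v.2)) ^ 2 := by
    intro v
    have e := Finset.sum_range_sub (fun i : ℕ => f (v.1 + i, v.2)) j
    simp only [Nat.cast_zero, add_zero] at e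
    rw [← e]
    refine (sq_sum_le_card_mul_sum_sq).trans (le_of_eq ?_)
    simp [add_assoc]
  refine (Finset.sum_le_sum fun v _ => h v).trans (le_of_eq ?_)
  rw [← Finset.mul_sum, Finset.sum_comm]
  have : ∀ i ∈ range j, ∑ v : ZMod 32 × P, (f (v.1 + i + 1, v.2) - f (v.1 + i, v.2)) ^ 2 =
      ∑ v : ZMod 32 × P, (f (v.1 + 1, v.2) - f v) ^ 2 := fun i _ =>
    sum_shift_fst (fun v => (f (v.1 + 1, v.2) - f v) ^ 2) i
  rw [Finset.sum_congr rfl this]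
  simp; ring

/-- A function on `ℤ/32 × P` of mean zero is bounded by its variation in the first variable and
along four permutations of `P` that satisfy a Poincaré inequality. -/
theorem sum_sq_le_of_fibre_poincare (M : ℕ → Equiv.Perm P)
    (hM : ∀ g : P → ℝ, ∑ p, g p = 0 →
      ∑ p, g p ^ 2 ≤ 18 * ∑ j ∈ Icc 1 4, ∑ p, (g (M j p) - g p) ^ 2)
    (f : ZMod 32 × P → ℝ) (hf : ∑ v, f v = 0) (D : ℝ)
    (h1 : ∑ v : ZMod 32 × P, (f (v.1 + 1, v.2) - f v) ^ 2 ≤ D)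
    (h2 : ∀ j ∈ Icc 1 4, ∑ v : ZMod 32 × P, (f (v.1, M j v.2) - f v) ^ 2 ≤ 34 * D) :
    ∑ v, f v ^ 2 ≤ 6818 * D := by
  rcases isEmpty_or_nonempty P with hP | hP
  · simp only [univ_eq_empty, sum_empty] at h1 ⊢
    linarith
  set N : ℝ := (Fintype.card P : ℝ) with hN
  have hNpos : 0 < N := by rw [hN]; exact_mod_cast Fintype.card_pos
  have hNne := hNpos.ne'
  -- Split `f` into its fibre means `h` and the rest: the torus inequality controls the rest (`2448
  -- = 18 · 4 · 34`), the cycle controls `h` (`961 = 31²`), and `6818 = 2 (2448 + 961)`.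
  set h : ZMod 32 → ℝ := fun t => (∑ p, f (t, p)) / N with hh
  have hsum : ∑ t, h t = 0 := by
    rw [hh, ← Finset.sum_div, ← Fintype.sum_prod_type', hf, zero_div]
  have hD : 0 ≤ D := le_trans (Finset.sum_nonneg fun _ _ => sq_nonneg _) h1
  have a1 : ∑ v : ZMod 32 × P, (f v - h v.1) ^ 2 ≤ 2448 * D := by
    have key : ∀ t, ∑ p, (f (t, p) - h t) ^ 2 ≤
        18 * ∑ j ∈ Icc 1 4, ∑ p, (f (t, M j p) - f (t, p)) ^ 2 := by
      intro t
      have := hM (fun p => f (t, p) - h t) (by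
        simp only [hh, Finset.sum_sub_distrib, Finset.sum_const, Finset.card_univ, nsmul_eq_mul]
        rw [← hN]; field_simp; ring)
      simpa using this
    rw [Fintype.sum_prod_type]
    refine (Finset.sum_le_sum fun t _ => key t).trans ?_
    rw [← Finset.mul_sum, Finset.sum_comm]
    simp_rw [← Fintype.sum_prod_type' (f := fun (t : ZMod 32) p => (f (t, M _ p) - f (t, p)) ^ 2)]
    have := Finset.sum_le_sum h2
    simp only [Finset.sum_const, Nat.card_Icc, nsmul_eq_mul] at this
    norm_num at this
    linarith
  have a2 : ∑ v : ZMod 32 × P, h v.1 ^ 2 ≤ 961 * D := by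
    have b1 : ∀ t δ, N * (h (t + δ) - h t) ^ 2 ≤ ∑ p, (f (t + δ, p) - f (t, p)) ^ 2 := by
      intro t δ
      have : h (t + δ) - h t = (∑ p, (f (t + δ, p) - f (t, p))) / N := by
        simp only [hh]; rw [Finset.sum_sub_distrib, sub_div]
      rw [this, div_pow, ← mul_div_assoc, div_le_iff₀ (by positivity), sq N]
      have := sq_sum_le_card_mul_sum_sq (s := (univ : Finset P))
        (f := fun p => f (t + δ, p) - f (t, p))
      rw [Finset.card_univ, ← hN] at this
      nlinarith
    -- As `h` has mean zero, its increments from `t` sum to `-32 h t`.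
    have b2 : ∀ t, 32 * h t ^ 2 ≤ ∑ δ, (h (t + δ) - h t) ^ 2 := by
      intro t
      have e : ∑ δ, (h (t + δ) - h t) = - (32 * h t) := by
        rw [Finset.sum_sub_distrib,
          show ∑ δ, h (t + δ) = ∑ δ, h δ from Equiv.sum_comp (Equiv.addLeft t) h,
          hsum]
        simp [ZMod.card]
      have := sq_sum_le_card_mul_sum_sq (s := (univ : Finset (ZMod 32)))
        (f := fun δ => h (t + δ) - h t)
      rw [e, Finset.card_univ, ZMod.card] at this
      push_cast at this
      nlinarith
    have b3 : ∀ δ : ZMod 32, ∑ v : ZMod 32 × P, (f (v.1 + δ, v.2) - f v) ^ 2 ≤ 961 * D := by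
      intro δ
      have := sum_sq_shift_sub_le f δ.val
      rw [ZMod.natCast_zmod_val] at this
      refine this.trans (mul_le_mul ?_ h1 (Finset.sum_nonneg fun _ _ => sq_nonneg _) (by norm_num))
      have : (δ.val : ℝ) ≤ 31 := by
        have := ZMod.val_lt δ
        exact_mod_cast (by omega : δ.val ≤ 31)
      nlinarith [(Nat.cast_nonneg δ.val : (0 : ℝ) ≤ δ.val)]
    have b4 : 32 * ∑ v : ZMod 32 × P, h v.1 ^ 2 ≤ ∑ _δ : ZMod 32, 961 * D := by
      calc 32 * ∑ v : ZMod 32 × P, h v.1 ^ 2 = ∑ t, N * (32 * h t ^ 2) := by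
            rw [Fintype.sum_prod_type, Finset.mul_sum]
            refine Finset.sum_congr rfl fun t _ => ?_
            simp only [Finset.sum_const, Finset.card_univ, nsmul_eq_mul, ← hN]; ring
        _ ≤ ∑ t, N * ∑ δ, (h (t + δ) - h t) ^ 2 :=
            Finset.sum_le_sum fun t _ => mul_le_mul_of_nonneg_left (b2 t) hNpos.le
        _ ≤ ∑ t, ∑ δ, ∑ p, (f (t + δ, p) - f (t, p)) ^ 2 := by
            refine Finset.sum_le_sum fun t _ => ?_
            rw [Finset.mul_sum]
            exact Finset.sum_le_sum fun δ _ => b1 t δ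
        _ = ∑ δ, ∑ v : ZMod 32 × P, (f (v.1 + δ, v.2) - f v) ^ 2 := by
            rw [Finset.sum_comm]
            refine Finset.sum_congr rfl fun δ _ => ?_
            rw [Fintype.sum_prod_type]
        _ ≤ _ := Finset.sum_le_sum fun δ _ => b3 δ
    rw [Finset.sum_const, Finset.card_univ, ZMod.card, nsmul_eq_mul] at b4
    push_cast at b4
    linarith
  have a3 : ∑ v, f v ^ 2 ≤ ∑ v : ZMod 32 × P, (2 * (f v - h v.1) ^ 2 + 2 * h v.1 ^ 2) :=
    Finset.sum_le_sum fun v _ => by nlinarith [sq_nonneg (f v - 2 * h v.1)]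
  rw [Finset.sum_add_distrib, ← Finset.mul_sum, ← Finset.mul_sum] at a3
  linarith

/-- The graph on `ℤ/32 × P` that joins `(t, p)` to `(t + δ, M δ p)` for `δ ≠ 0` has a spectral gap
if `M 1, …, M 4` satisfy a Poincaré inequality and `M 5 = M 6 = 1`. -/
theorem sum_sq_sum_le_of_fibre_poincare (M : ZMod 32 → Equiv.Perm P)
    (hM : ∀ g : P → ℝ, ∑ p, g p = 0 →
      ∑ p, g p ^ 2 ≤ 18 * ∑ j ∈ Icc 1 4, ∑ p, (g (M (j : ℕ) p) - g p) ^ 2)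
    (h5 : M 5 = 1) (h6 : M 6 = 1)
    (f : ZMod 32 × P → ℝ) (hf : ∑ v, f v = 0) :
    ∑ v : ZMod 32 × P, (∑ δ ∈ univ.erase 0, f (v.1 + δ, M δ v.2)) ^ 2 ≤
      (961 - 1 / 13636) * ∑ v, f v ^ 2 := by
  set D := ∑ δ ∈ univ.erase 0, ∑ δ' ∈ univ.erase 0,
    ∑ v : ZMod 32 × P, (f (v.1 + δ, M δ v.2) - f (v.1 + δ', M δ' v.2)) ^ 2 with hD
  have hDle : ∀ δ δ' : ZMod 32, δ ≠ 0 → δ' ≠ 0 →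
      ∑ v : ZMod 32 × P, (f (v.1 + δ, M δ v.2) - f (v.1 + δ', M δ' v.2)) ^ 2 ≤ D := by
    intro δ δ' h h'
    have n : ∀ δ δ' : ZMod 32, 0 ≤
        ∑ v : ZMod 32 × P, (f (v.1 + δ, M δ v.2) - f (v.1 + δ', M δ' v.2)) ^ 2 :=
      fun _ _ => Finset.sum_nonneg fun _ _ => sq_nonneg _
    refine (Finset.single_le_sum (f := fun δ' => ∑ v : ZMod 32 × P,
      (f (v.1 + δ, M δ v.2) - f (v.1 + δ', M δ' v.2)) ^ 2) (fun i _ => n δ i)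
      (Finset.mem_erase.2 ⟨h', Finset.mem_univ _⟩)).trans ?_
    exact Finset.single_le_sum (f := fun δ => ∑ δ' ∈ univ.erase 0, ∑ v : ZMod 32 × P,
      (f (v.1 + δ, M δ v.2) - f (v.1 + δ', M δ' v.2)) ^ 2)
      (fun i _ => Finset.sum_nonneg fun j _ => n i j)
      (Finset.mem_erase.2 ⟨h, Finset.mem_univ _⟩)
  -- Moves 6 and 5 are trivial on `P` and differ by one unit shift.
  have r1 : ∑ v : ZMod 32 × P, (f (v.1 + 1, v.2) - f v) ^ 2 ≤ D := by
    have := hDle 6 5 (by decide) (by decide)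
    rw [h5, h6] at this
    rw [← sum_shift_fst (fun v => (f (v.1 + 1, v.2) - f v) ^ 2) 5]
    refine le_trans (le_of_eq (Finset.sum_congr rfl fun v _ => ?_)) this
    simp only [Equiv.Perm.coe_one, id_eq, add_assoc]
    norm_num
  have hD0 : 0 ≤ D := le_trans (Finset.sum_nonneg fun _ _ => sq_nonneg _) r1
  -- Move `j` is compared with move 5, and the remaining shift by `5 - j ≤ 4` costs at most `16 D`;
  -- doubling both gives `2 + 32 = 34`.
  have r2 : ∀ j ∈ Icc 1 4, ∑ v : ZMod 32 × P, (f (v.1, M (j : ℕ) v.2) - f v) ^ 2 ≤ 34 * D := by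
    intro j hj
    rw [mem_Icc] at hj
    have c1 := hDle (j : ℕ) 5 (by
      obtain ⟨h, h'⟩ := hj; interval_cases j <;> decide) (by decide)
    have c2 := sum_sq_shift_sub_le f (5 - j)
    rw [← sum_shift_fst (fun v => (f (v.1 + ((5 - j : ℕ) : ZMod 32), v.2) - f v) ^ 2) (j : ℕ)] at c2
    rw [← sum_shift_fst (fun v => (f (v.1, M (j : ℕ) v.2) - f v) ^ 2) (j : ℕ)]
    have c3 : ((5 - j : ℕ) : ℝ) ^ 2 ≤ 16 := by
      have : ((5 - j : ℕ) : ℝ) ≤ 4 := by exact_mod_cast (by omega : 5 - j ≤ 4)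
      nlinarith [(Nat.cast_nonneg (5 - j) : (0 : ℝ) ≤ ((5 - j : ℕ) : ℝ))]
    have c4 := c2.trans (mul_le_mul c3 r1 (Finset.sum_nonneg fun _ _ => sq_nonneg _) (by norm_num))
    have c5 : ∑ v : ZMod 32 × P, (f (v.1 + (j : ℕ), M (j : ℕ) v.2) - f (v.1 + (j : ℕ), v.2)) ^ 2 ≤
        2 * ∑ v : ZMod 32 × P, (f (v.1 + (j : ℕ), M (j : ℕ) v.2) - f (v.1 + 5, M 5 v.2)) ^ 2 +
        2 * ∑ v : ZMod 32 × P,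
          (f (v.1 + (j : ℕ) + ((5 - j : ℕ) : ZMod 32), v.2) - f (v.1 + (j : ℕ), v.2)) ^ 2 := by
      rw [Finset.mul_sum, Finset.mul_sum, ← Finset.sum_add_distrib]
      refine Finset.sum_le_sum fun v _ => ?_
      have e : v.1 + (j : ℕ) + ((5 - j : ℕ) : ZMod 32) = v.1 + 5 := by
        rw [Nat.cast_sub (by omega)]; push_cast; ring
      rw [e, h5]
      simp only [Equiv.Perm.coe_one, id_eq]
      nlinarith [sq_nonneg ((f (v.1 + (j : ℕ), M (j : ℕ) v.2) - f (v.1 + 5, v.2)) -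
        (f (v.1 + 5, v.2) - f (v.1 + (j : ℕ), v.2)))]
    linarith
  have r3 := sum_sq_le_of_fibre_poincare (fun j => M (j : ℕ)) hM f hf D r1 r2
  -- Each move is a bijection, so Lagrange's identity at every vertex leaves exactly `31² ∑ f² -
  -- D/2`; with `∑ f² ≤ 6818 D` the loss is `1/13636`.
  have r4 : ∑ v : ZMod 32 × P, (∑ δ ∈ univ.erase 0, f (v.1 + δ, M δ v.2)) ^ 2 =
      961 * ∑ v, f v ^ 2 - 1 / 2 * D := by
    have hc : (univ.erase (0 : ZMod 32)).card = 31 := by decide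
    have s1 : ∀ δ : ZMod 32, ∑ v : ZMod 32 × P, f (v.1 + δ, M δ v.2) ^ 2 = ∑ v, f v ^ 2 := fun δ =>
      Equiv.sum_comp ((Equiv.addRight δ).prodCongr (M δ)) (fun v => f v ^ 2)
    simp_rw [sq_sum_eq_card_mul_sub]
    rw [Finset.sum_sub_distrib, ← Finset.mul_sum, ← Finset.mul_sum, Finset.sum_comm]
    simp_rw [s1]
    rw [Finset.sum_const, hc, hD, Finset.sum_comm]
    congr 1
    · simp; ring
    · congr 1
      refine Finset.sum_congr rfl fun δ _ => ?_
      rw [Finset.sum_comm]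
  rw [r4]
  linarith

end Tower

/-! ### Binary encoding of words -/

section Encoding

theorem wordBits_eq_natCast {k : ℕ} (w : Fin k → ℤˣ) (s m : ℕ) :
    wordBits w s m = ((∑ j ∈ (univ.filter fun i : Fin k =>
      s ≤ (i : ℕ) ∧ (i : ℕ) < s + m ∧ w i = 1).image fun i : Fin k => (i : ℕ) - s, 2 ^ j : ℕ) :
        ZMod (2 ^ m)) := by
  classical
  rw [Finset.sum_image, Finset.sum_filter, wordBits]
  · push_cast
    refine Finset.sum_congr rfl fun i _ => ?_
    split_ifs <;> simp
  · intro i hi j hj h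
    simp only [mem_coe, mem_filter, mem_univ, true_and] at hi hj h
    exact Fin.ext (by omega)

/-- Both sums of distinct powers lie below `2 ^ m`, so congruence is equality, and binary expansions
are unique. -/
theorem eq_of_wordBits_eq {k : ℕ} {w w' : Fin k → ℤˣ} {s m : ℕ}
    (h : wordBits w s m = wordBits w' s m) (i : Fin k) (h1 : s ≤ (i : ℕ)) (h2 : (i : ℕ) < s + m) :
    w i = w' i := by
  classical
  have lt : ∀ w : Fin k → ℤˣ, (∑ j ∈ (univ.filter fun i : Fin k =>
      s ≤ (i : ℕ) ∧ (i : ℕ) < s + m ∧ w i = 1).image fun i : Fin k => (i : ℕ) - s, 2 ^ j) <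
        2 ^ m := by
    intro w
    apply Nat.geomSum_lt le_rfl
    intro j hj
    simp only [mem_image, mem_filter, mem_univ, true_and] at hj
    obtain ⟨i, hi, rfl⟩ := hj
    omega
  rw [wordBits_eq_natCast, wordBits_eq_natCast, ZMod.natCast_eq_natCast_iff] at h
  have h3 := Finset.geomSum_injective le_rfl (Nat.ModEq.eq_of_lt_of_lt h (lt w) (lt w'))
  have key : ∀ w : Fin k → ℤˣ, w i = 1 ↔ (i : ℕ) - s ∈ (univ.filter fun i : Fin k =>
      s ≤ (i : ℕ) ∧ (i : ℕ) < s + m ∧ w i = 1).image fun i : Fin k => (i : ℕ) - s := by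
    intro w
    simp only [mem_image, mem_filter, mem_univ, true_and]
    constructor
    · intro h; exact ⟨i, ⟨h1, h2, h⟩, rfl⟩
    · rintro ⟨j, ⟨a1, a2, a3⟩, a4⟩
      have : j = i := Fin.ext (by omega)
      rwa [← this]
  have h4 : w i = 1 ↔ w' i = 1 := by rw [key w, h3, ← key w']
  clear key h3 h lt
  rcases Int.units_eq_one_or (w i) with a | a <;> rcases Int.units_eq_one_or (w' i) with b | b <;>
    simp_all

/-- The triple that a word stands for. -/
def wordTriple {k : ℕ} (w : Fin k → ℤˣ) :
    ZMod 32 × (ZMod (2 ^ ((k - 5) / 2)) × ZMod (2 ^ ((k - 4) / 2))) :=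
  (wordBits w 0 5, wordPoint w)

theorem bijective_wordTriple {k : ℕ} (hk : 5 ≤ k) :
    Function.Bijective (wordTriple : (Fin k → ℤˣ) → _) := by
  rw [Fintype.bijective_iff_injective_and_card]
  constructor
  · intro w w' h
    simp only [wordTriple, wordPoint, Prod.mk.injEq] at h
    obtain ⟨h1, h2, h3⟩ := h
    ext i
    congr 1
    by_cases c1 : (i : ℕ) < 5
    · exact eq_of_wordBits_eq h1 i (by omega) (by omega)
    by_cases c2 : (i : ℕ) < 5 + (k - 5) / 2
    · exact eq_of_wordBits_eq h2 i (by omega) (by omega)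
    · exact eq_of_wordBits_eq h3 i (by omega) (by omega)
  · rw [Fintype.card_prod, Fintype.card_prod, ZMod.card, ZMod.card, ZMod.card, Fintype.card_fun,
      Fintype.card_units_int, Fintype.card_fin, ← pow_add, show 32 = 2 ^ 5 by norm_num, ← pow_add]
    congr 1
    omega

end Encoding

/-! ### The shears of the rectangular torus -/

section Shears

/-- The additive automorphism `(x, y) ↦ (x + h y, y)`. -/
def shearFst {X Y : Type*} [AddCommGroup X] [AddCommGroup Y] (h : Y →+ X) : X × Y ≃+ X × Y where
  toFun p := (p.1 + h p.2, p.2)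
  invFun p := (p.1 - h p.2, p.2)
  left_inv p := by simp
  right_inv p := by simp
  map_add' p q := by simp; abel

/-- The additive automorphism `(x, y) ↦ (x, y + h x)`. -/
def shearSnd {X Y : Type*} [AddCommGroup X] [AddCommGroup Y] (h : X →+ Y) : X × Y ≃+ X × Y where
  toFun p := (p.1, p.2 + h p.1)
  invFun p := (p.1, p.2 - h p.1)
  left_inv p := by simp
  right_inv p := by simp
  map_add' p q := by simp; abel

/-- Doubling is well defined from `ℤ/m` to `ℤ/n` as soon as `2m` vanishes in `ℤ/n`. This is why
sides `2ᵃ`, `2ᵇ` with `b = a + 1` are allowed, and so word lengths of both parities. -/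
theorem exists_addMonoidHom_two_mul_val {m n : ℕ} [NeZero m] (h : n ∣ 2 * m) :
    ∃ c : ZMod m →+ ZMod n, c 1 = 2 ∧ ∀ y, c y = 2 * (y.val : ZMod n) := by
  refine ⟨ZMod.lift m ⟨zmultiplesHom (ZMod n) 2, ?_⟩, ?_, ?_⟩
  · simp only [zmultiplesHom_apply, natCast_zsmul, nsmul_eq_mul]
    have := (ZMod.natCast_eq_zero_iff (2 * m) n).2 h
    push_cast at this
    rw [mul_comm]; exact this
  · have := ZMod.lift_coe m ⟨zmultiplesHom (ZMod n) 2, by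
      simp only [zmultiplesHom_apply, natCast_zsmul, nsmul_eq_mul]
      have := (ZMod.natCast_eq_zero_iff (2 * m) n).2 h
      push_cast at this
      rw [mul_comm]; exact this⟩ 1
    simpa using this
  · intro y
    have := ZMod.lift_coe m ⟨zmultiplesHom (ZMod n) 2, by
      simp only [zmultiplesHom_apply, natCast_zsmul, nsmul_eq_mul]
      have := (ZMod.natCast_eq_zero_iff (2 * m) n).2 h
      push_cast at this
      rw [mul_comm]; exact this⟩ (y.val : ℤ)
    rw [Int.cast_natCast, ZMod.natCast_zmod_val] at this
    rw [this]
    simp [mul_comm]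

theorem addChar_zmod_prod_eq_zero {m n : ℕ} [NeZero m] [NeZero n]
    (ψ : AddChar (ZMod m × ZMod n) ℂ) (h1 : ψ (1, 0) = 1) (h2 : ψ (0, 1) = 1) : ψ = 0 := by
  ext ⟨x, y⟩
  have : ((x, y) : ZMod m × ZMod n) = x.val • (1, 0) + y.val • (0, 1) := by
    ext <;> simp
  rw [this, AddChar.map_add_eq_mul, AddChar.map_nsmul_eq_pow, AddChar.map_nsmul_eq_pow, h1, h2]
  simp

theorem exists_shearPerm_poincare {a b : ℕ} (hab : a ≤ b) (hba : b ≤ a + 1) :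
    ∃ S : ℕ → Equiv.Perm (ZMod (2 ^ a) × ZMod (2 ^ b)), (∀ j p, S j p = shear a b j p) ∧
      ∀ g : ZMod (2 ^ a) × ZMod (2 ^ b) → ℝ, ∑ p, g p = 0 →
        ∑ p, g p ^ 2 ≤ 18 * ∑ j ∈ Icc 1 4, ∑ p, (g (S j p) - g p) ^ 2 := by
  obtain ⟨c, c1, hc⟩ := exists_addMonoidHom_two_mul_val (m := 2 ^ b) (n := 2 ^ a)
    ((pow_dvd_pow 2 hab).mul_left 2)
  obtain ⟨d, d1, hd⟩ := exists_addMonoidHom_two_mul_val (m := 2 ^ a) (n := 2 ^ b)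
    (by rw [← pow_succ']; exact pow_dvd_pow 2 hba)
  let S : ℕ → Equiv.Perm (ZMod (2 ^ a) × ZMod (2 ^ b)) := fun
    | 1 => (shearFst c).toEquiv
    | 2 => (shearFst c).toEquiv.trans (Equiv.addRight (1, 0))
    | 3 => (shearSnd d).toEquiv
    | 4 => (shearSnd d).toEquiv.trans (Equiv.addRight (0, 1))
    | _ => Equiv.refl _
  refine ⟨S, ?_, ?_⟩
  · rintro j ⟨x, y⟩
    match j with
    | 0 => rfl
    | 1 => simp [S, shear, shearFst, hc]
    | 2 => simp [S, shear, shearFst, hc]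
    | 3 => simp [S, shear, shearSnd, hd]
    | 4 => simp [S, shear, shearSnd, hd]
    | n + 5 => rfl
  · intro g hg
    have := sum_sq_le_of_shears (shearFst c) (shearSnd d) (1, 0) (0, 1)
      (by simp [shearFst]) (by simp [shearFst, c1]; norm_num) (by simp [shearSnd])
      (by simp [shearSnd, d1]; norm_num) addChar_zmod_prod_eq_zero g hg
    refine this.trans (le_of_eq ?_)
    rw [show Icc 1 4 = ({1, 2, 3, 4} : Finset ℕ) from rfl]
    rw [Finset.sum_insert (by simp), Finset.sum_insert (by simp), Finset.sum_insert (by simp),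
      Finset.sum_singleton]
    simp only [S, ← add_assoc]
    rfl

end Shears

/-! ### Spectral gap of the explicit graph -/

section Expander

theorem l2Norm_le_of_sum_sq_le {V : Type*} [Fintype V] {f g : V → ℝ} {c : ℝ} (hc : 0 ≤ c)
    (h : ∑ v, g v ^ 2 ≤ c * ∑ v, f v ^ 2) : l2Norm g ≤ √c * l2Norm f := by
  rw [l2Norm, l2Norm, ← Real.sqrt_mul hc, ← Finset.sum_mul, ← Finset.sum_mul, ← mul_assoc]
  exact Real.sqrt_le_sqrt (mul_le_mul_of_nonneg_right h (by positivity))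

theorem sum_sq_le_of_l2Norm_le {V : Type*} [Fintype V] [Nonempty V] {f g : V → ℝ} {c : ℝ}
    (h : l2Norm g ≤ c * l2Norm f) : ∑ v, g v ^ 2 ≤ c ^ 2 * ∑ v, f v ^ 2 := by
  have hN : (0 : ℝ) < 1 / (Fintype.card V : ℝ) := by
    have : (0 : ℝ) < Fintype.card V := by exact_mod_cast Fintype.card_pos
    positivity
  have h0 : 0 ≤ l2Norm g := Real.sqrt_nonneg _
  have h1 := pow_le_pow_left₀ h0 h 2
  rw [mul_pow, l2Norm, l2Norm, Real.sq_sqrt (Finset.sum_nonneg fun _ _ => by positivity),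
    Real.sq_sqrt (Finset.sum_nonneg fun _ _ => by positivity), ← Finset.sum_mul, ← Finset.sum_mul,
    ← mul_assoc] at h1
  exact le_of_mul_le_mul_right h1 hN

theorem normAdj_sub_avgMatrix_mulVec {V : Type*} [Fintype V] (G : SimpleGraph V) (d : ℕ)
    (f : V → ℝ) (v : V) :
    Matrix.mulVec (normAdj G d - avgMatrix V) f v =
      Matrix.mulVec (normAdj G d) f v - (∑ w, f w) / Fintype.card V := by
  rw [Matrix.sub_mulVec, Pi.sub_apply]
  congr 1
  simp [avgMatrix, Matrix.mulVec, dotProduct, ← Finset.mul_sum, div_eq_inv_mul]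

/-- Nonzero differences `δ` index the neighbours injectively, which gives degree 31. Subtracting `J`
amounts to centring `f`, which does not increase its norm, so the bound for mean zero applies. -/
theorem isSpectralExpander_of_fibre_poincare {V P : Type*} [Fintype V] [Fintype P]
    (G : SimpleGraph V) (Φ : V ≃ ZMod 32 × P) (M : ZMod 32 → Equiv.Perm P)
    (hadj : ∀ v w, G.Adj v w ↔ (Φ w).1 ≠ (Φ v).1 ∧ (Φ w).2 = M ((Φ w).1 - (Φ v).1) (Φ v).2)
    (hM : ∀ g : P → ℝ, ∑ p, g p = 0 →
      ∑ p, g p ^ 2 ≤ 18 * ∑ j ∈ Icc 1 4, ∑ p, (g (M (j : ℕ) p) - g p) ^ 2)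
    (h5 : M 5 = 1) (h6 : M 6 = 1) :
    IsSpectralExpander G 31 (√((961 - 1 / 13636) / 961)) := by
  classical
  have nb : ∀ v, (univ.filter fun w => G.Adj v w) =
      (univ.erase 0).image fun δ => Φ.symm ((Φ v).1 + δ, M δ (Φ v).2) := by
    intro v
    ext w
    simp only [mem_filter, mem_univ, true_and, hadj, mem_image, mem_erase, and_true]
    constructor
    · rintro ⟨h1, h2⟩
      refine ⟨(Φ w).1 - (Φ v).1, sub_ne_zero.2 h1, ?_⟩
      rw [Equiv.symm_apply_eq, ← h2]
      ext <;> simp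
    · rintro ⟨δ, h1, rfl⟩
      simp [h1]
  have inj : ∀ v, Function.Injective fun δ => Φ.symm ((Φ v).1 + δ, M δ (Φ v).2) := by
    intro v δ δ' h
    have := Φ.symm.injective h
    simp only [Prod.mk.injEq, add_right_inj] at this
    exact this.1
  have hc : (univ.erase (0 : ZMod 32)).card = 31 := by decide
  have hA : ∀ (f : V → ℝ) v, Matrix.mulVec (normAdj G 31) f v =
      1 / 31 * ∑ δ ∈ univ.erase 0, f (Φ.symm ((Φ v).1 + δ, M δ (Φ v).2)) := by
    intro f v
    rw [← Finset.sum_image (f := f) (s := univ.erase 0)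
      (g := fun δ => Φ.symm ((Φ v).1 + δ, M δ (Φ v).2)) (fun _ _ _ _ e => inj v e), ← nb,
      Finset.sum_filter, Finset.mul_sum]
    simp only [normAdj, Matrix.mulVec, dotProduct, Matrix.of_apply]
    refine Finset.sum_congr rfl fun w _ => ?_
    split_ifs <;> simp
  refine ⟨?_, ?_⟩
  · intro v
    rw [← Finset.coe_filter_univ, Set.ncard_coe_finset, nb,
      Finset.card_image_of_injective _ (inj v), hc]
  · intro f
    rcases isEmpty_or_nonempty V with hV | hV
    · simp [l2Norm]
    apply l2Norm_le_of_sum_sq_le (by norm_num)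
    have hN : (Fintype.card V : ℝ) ≠ 0 := by exact_mod_cast Fintype.card_ne_zero
    set m := (∑ w, f w) / Fintype.card V with hm
    have hms : ∑ w, (f w - m) = 0 := by
      rw [Finset.sum_sub_distrib, Finset.sum_const, Finset.card_univ, nsmul_eq_mul, hm]
      field_simp; ring
    have h1 := sum_sq_sum_le_of_fibre_poincare M hM h5 h6 (fun x => f (Φ.symm x) - m)
      (by rw [Equiv.sum_comp Φ.symm (fun v => f v - m)]; exact hms)
    rw [Equiv.sum_comp Φ.symm (fun v => (f v - m) ^ 2), ← Equiv.sum_comp Φ] at h1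
    have h2 : ∑ v, (f v - m) ^ 2 ≤ ∑ v, f v ^ 2 := by
      have : ∑ v, f v ^ 2 = ∑ v, (f v - m) ^ 2 + 2 * m * ∑ v, (f v - m) + ∑ _v : V, m ^ 2 := by
        rw [Finset.mul_sum, ← Finset.sum_add_distrib, ← Finset.sum_add_distrib]
        exact Finset.sum_congr rfl fun _ _ => by ring
      rw [this, hms]
      have : 0 ≤ ∑ _v : V, m ^ 2 := Finset.sum_nonneg fun _ _ => sq_nonneg _
      linarith
    have h3 : ∀ v, Matrix.mulVec (normAdj G 31 - avgMatrix V) f v ^ 2 = 1 / 961 *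
        (∑ δ ∈ univ.erase 0, (f (Φ.symm ((Φ v).1 + δ, M δ (Φ v).2)) - m)) ^ 2 := by
      intro v
      rw [normAdj_sub_avgMatrix_mulVec, ← hm, hA, Finset.sum_sub_distrib, Finset.sum_const, hc]
      simp only [nsmul_eq_mul]
      push_cast
      ring
    simp_rw [h3, ← Finset.mul_sum]
    linarith

theorem shear_eq_self {a b j : ℕ} (h : 5 ≤ j) (p : ZMod (2 ^ a) × ZMod (2 ^ b)) :
    shear a b j p = p := by
  match j, h with
  | n + 5, _ => rfl

theorem isSpectralExpander_explicitGraph {k : ℕ} (hk : 5 ≤ k) :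
    IsSpectralExpander (explicitGraph k) 31 (√((961 - 1 / 13636) / 961)) := by
  obtain ⟨S, hS, hP⟩ := exists_shearPerm_poincare (a := (k - 5) / 2) (b := (k - 4) / 2)
    (by omega) (by omega)
  have hS1 : ∀ j, 5 ≤ j → S j = 1 := by
    intro j hj; ext1 p; rw [hS, shear_eq_self hj]; rfl
  -- Adjacency is symmetric, so the move by `-j` must be the inverse of the move by `j`.
  set M : ZMod 32 → Equiv.Perm _ := fun δ => if δ.val ≤ 16 then S δ.val else (S (32 - δ.val))⁻¹
    with hM
  have hval : ∀ j : ℕ, j < 32 → (j : ZMod 32).val = j := fun j hj => ZMod.val_cast_of_lt hj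
  have hval' : ∀ j : ℕ, 1 ≤ j → j < 32 → (-(j : ZMod 32)).val = 32 - j := by
    intro j h1 h2
    have : -(j : ZMod 32) = ((32 - j : ℕ) : ZMod 32) := by
      rw [Nat.cast_sub h2.le, Nat.cast_ofNat, show (32 : ZMod 32) = 0 from rfl, zero_sub]
    rw [this, hval _ (by omega)]
  have hMpos : ∀ j : ℕ, j ≤ 16 → M (j : ℕ) = S j := by
    intro j hj
    simp only [hM]
    rw [hval j (by omega), if_pos hj]
  have hMneg : ∀ j : ℕ, 1 ≤ j → j ≤ 16 → M (-(j : ZMod 32)) = (S j)⁻¹ := by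
    intro j h1 hj
    simp only [hM]
    rw [hval' j h1 (by omega)]
    -- Only `j = 16`, which is its own negative, reaches the first branch; the definitions agree
    -- there because `S 16` is the identity.
    split_ifs with h
    · rw [hS1 _ (by omega), hS1 j (by omega), inv_one]
    · congr 2; omega
  apply isSpectralExpander_of_fibre_poincare _ (Equiv.ofBijective _ (bijective_wordTriple hk)) M
  · intro w w'
    simp only [Equiv.ofBijective_apply]
    rw [explicitGraph, SimpleGraph.fromRel_adj]
    have hne : ∀ j : ℕ, 1 ≤ j → j ≤ 16 → (j : ZMod 32) ≠ 0 := by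
      intro j h1 h2 h
      have := congrArg ZMod.val h
      rw [hval j (by omega), ZMod.val_zero] at this
      omega
    constructor
    · rintro ⟨-, ⟨j, h1, h2, h3, h4⟩ | ⟨j, h1, h2, h3, h4⟩⟩
      · have e : (wordTriple w').1 = (wordTriple w).1 + (j : ZMod 32) := h3
        have e2 : (wordTriple w').2 = S j (wordTriple w).2 := by rw [hS]; exact h4
        rw [e, add_sub_cancel_left, hMpos j h2]
        exact ⟨by simpa using hne j h1 h2, e2⟩
      · have e : (wordTriple w).1 = (wordTriple w').1 + (j : ZMod 32) := h3
        have e2 : (wordTriple w).2 = S j (wordTriple w').2 := by rw [hS]; exact h4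
        rw [e,
          show (wordTriple w').1 - ((wordTriple w').1 + (j : ZMod 32)) = -(j : ZMod 32) by ring,
          hMneg j h1 h2, e2]
        exact ⟨by simpa using hne j h1 h2, by simp⟩
    · rintro ⟨h1, h2⟩
      refine ⟨fun h => h1 (by rw [h]), ?_⟩
      set δ := (wordTriple w').1 - (wordTriple w).1 with hδ
      have hδ0 : δ.val ≠ 0 := by
        rw [Ne, ZMod.val_eq_zero]; exact sub_ne_zero.2 h1
      have hδ1 : δ.val < 32 := ZMod.val_lt δ
      by_cases hc : δ.val ≤ 16
      · left
        refine ⟨δ.val, by omega, hc, ?_, ?_⟩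
        · change (wordTriple w').1 = (wordTriple w).1 + ((δ.val : ℕ) : ZMod 32)
          rw [ZMod.natCast_zmod_val, hδ]; ring
        · rw [← hS, ← hMpos _ hc, ZMod.natCast_zmod_val]; exact h2
      · right
        have e : ((32 - δ.val : ℕ) : ZMod 32) = -δ := by
          rw [Nat.cast_sub hδ1.le, Nat.cast_ofNat, show (32 : ZMod 32) = 0 from rfl, zero_sub,
            ZMod.natCast_zmod_val]
        refine ⟨32 - δ.val, by omega, by omega, ?_, ?_⟩
        · change (wordTriple w).1 = (wordTriple w').1 + ((32 - δ.val : ℕ) : ZMod 32)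
          rw [e, hδ]; ring
        · have h3 : (wordTriple w').2 = (S (32 - δ.val))⁻¹ (wordTriple w).2 := by
            rw [h2]; simp only [hM]; rw [if_neg hc]
          rw [← hS, ← Equiv.Perm.inv_eq_iff_eq]
          exact h3.symm
  · intro g hg
    refine (hP g hg).trans (le_of_eq (congrArg (18 * ·) (Finset.sum_congr rfl fun j hj => ?_)))
    rw [mem_Icc] at hj
    rw [hMpos j (by omega)]
  · rw [← hS1 5 le_rfl]; exact hMpos 5 (by norm_num)
  · rw [← hS1 6 (by norm_num)]; exact hMpos 6 (by norm_num)

end Expander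

/-! ### Products of phases along a walk -/

section WalkOperator

variable {V : Type*} [Fintype V]

/-- The action of a real matrix on complex vectors. -/
noncomputable def matVec (A : Matrix V V ℝ) (x : V → ℂ) (v : V) : ℂ := ∑ w, (A v w : ℂ) * x w

/-- A doubly stochastic matrix which contracts the square of the norm of every real vector of mean
zero by the factor `c`. -/
structure IsMixing (A : Matrix V V ℝ) (c : ℝ) : Prop where
  row_sum : ∀ v, ∑ w, A v w = 1
  col_sum : ∀ w, ∑ v, A v w = 1
  contract : ∀ f : V → ℝ, ∑ v, f v = 0 → ∑ v, (A.mulVec f v) ^ 2 ≤ c * ∑ v, f v ^ 2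
  nonneg : 0 ≤ c
  le_one : c ≤ 1

theorem sum_matVec {A : Matrix V V ℝ} {c : ℝ} (hA : IsMixing A c) (x : V → ℂ) :
    ∑ v, matVec A x v = ∑ v, x v := by
  simp only [matVec]
  rw [Finset.sum_comm]
  refine Finset.sum_congr rfl fun w _ => ?_
  rw [← Finset.sum_mul]
  have := hA.col_sum w
  rw [show ∑ v, (A v w : ℂ) = 1 by exact_mod_cast this, one_mul]

theorem matVec_sub_const {A : Matrix V V ℝ} {c : ℝ} (hA : IsMixing A c) (x : V → ℂ) (m : ℂ)
    (v : V) : matVec A (fun w => x w - m) v = matVec A x v - m := by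
  simp only [matVec, mul_sub, Finset.sum_sub_distrib, ← Finset.sum_mul]
  have := hA.row_sum v
  rw [show ∑ w, (A v w : ℂ) = 1 by exact_mod_cast this, one_mul]

theorem sum_norm_sq_matVec_le_of_sum_eq_zero {A : Matrix V V ℝ} {c : ℝ} (hA : IsMixing A c)
    (x : V → ℂ) (hx : ∑ v, x v = 0) : ∑ v, ‖matVec A x v‖ ^ 2 ≤ c * ∑ v, ‖x v‖ ^ 2 := by
  have hre := hA.contract (fun v => (x v).re) (by rw [← Complex.re_sum, hx, Complex.zero_re])
  have him := hA.contract (fun v => (x v).im) (by rw [← Complex.im_sum, hx, Complex.zero_im])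
  have e : ∀ z : ℂ, ‖z‖ ^ 2 = z.re ^ 2 + z.im ^ 2 := fun z => by
    rw [← Complex.normSq_eq_norm_sq, Complex.normSq_apply]; ring
  have r : ∀ v, (matVec A x v).re = A.mulVec (fun v => (x v).re) v := fun v => by
    simp [matVec, Matrix.mulVec, dotProduct, Complex.re_sum]
  have i : ∀ v, (matVec A x v).im = A.mulVec (fun v => (x v).im) v := fun v => by
    simp [matVec, Matrix.mulVec, dotProduct, Complex.im_sum]
  simp_rw [e, r, i, Finset.sum_add_distrib]
  linarith

/-- The mean of a complex function on a finite type. -/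
noncomputable def meanValue (x : V → ℂ) : ℂ := (∑ v, x v) / Fintype.card V

theorem sum_sub_meanValue [Nonempty V] (x : V → ℂ) : ∑ v, (x v - meanValue x) = 0 := by
  have hN : (Fintype.card V : ℂ) ≠ 0 := by exact_mod_cast Fintype.card_ne_zero
  rw [Finset.sum_sub_distrib, Finset.sum_const, Finset.card_univ, nsmul_eq_mul, meanValue]
  field_simp; ring

theorem sum_norm_sq_eq_add_of_sum_sub_eq_zero (x : V → ℂ) (m : ℂ) (h : ∑ v, (x v - m) = 0) :
    ∑ v, ‖x v‖ ^ 2 = Fintype.card V * ‖m‖ ^ 2 + ∑ v, ‖x v - m‖ ^ 2 := by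
  have e : ∀ v, ‖x v‖ ^ 2 = ‖m‖ ^ 2 + ‖x v - m‖ ^ 2 +
      2 * ((starRingEnd ℂ m) * (x v - m)).re := by
    intro v
    simp only [← Complex.normSq_eq_norm_sq, Complex.normSq_apply, Complex.mul_re, Complex.conj_re,
      Complex.conj_im, Complex.sub_re, Complex.sub_im]
    ring
  simp_rw [e, Finset.sum_add_distrib, ← Finset.mul_sum, ← Complex.re_sum, ← Finset.mul_sum, h]
  simp

/-- By Pythagoras: the mean is preserved, and the orthogonal part contracts by `c`. -/
theorem sum_norm_sq_matVec_le [Nonempty V] {A : Matrix V V ℝ} {c : ℝ} (hA : IsMixing A c)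
    (x : V → ℂ) : ∑ v, ‖matVec A x v‖ ^ 2 ≤
      c * ∑ v, ‖x v‖ ^ 2 + (1 - c) * (Fintype.card V * ‖meanValue x‖ ^ 2) := by
  have h0 := sum_sub_meanValue x
  have h1 := sum_norm_sq_eq_add_of_sum_sub_eq_zero x _ h0
  have h2 := sum_norm_sq_eq_add_of_sum_sub_eq_zero (matVec A x) (meanValue x) (by
    simp_rw [← matVec_sub_const hA]
    rw [sum_matVec hA, h0])
  have h3 := sum_norm_sq_matVec_le_of_sum_eq_zero hA _ h0
  simp_rw [matVec_sub_const hA] at h3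
  rw [h2, h1]
  linarith

theorem sum_norm_sq_matVec_le_self [Nonempty V] {A : Matrix V V ℝ} {c : ℝ} (hA : IsMixing A c)
    (x : V → ℂ) : ∑ v, ‖matVec A x v‖ ^ 2 ≤ ∑ v, ‖x v‖ ^ 2 := by
  have h1 := sum_norm_sq_eq_add_of_sum_sub_eq_zero x _ (sum_sub_meanValue x)
  have h2 := sum_norm_sq_matVec_le hA x
  have h3 : 0 ≤ ∑ v, ‖x v - meanValue x‖ ^ 2 := Finset.sum_nonneg fun _ _ => sq_nonneg _
  nlinarith [hA.le_one]

theorem norm_sum_mul_sq_le (x y : V → ℂ) :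
    ‖∑ v, x v * y v‖ ^ 2 ≤ (∑ v, ‖x v‖ ^ 2) * ∑ v, ‖y v‖ ^ 2 := by
  have h : ‖∑ v, x v * y v‖ ≤ ∑ v, ‖x v‖ * ‖y v‖ :=
    (norm_sum_le _ _).trans (le_of_eq (by simp))
  exact (pow_le_pow_left₀ (norm_nonneg _) h 2).trans (Finset.sum_mul_sq_le_sq_mul_sq _ _ _)

theorem card_mul_norm_meanValue_sq_le [Nonempty V] (x : V → ℂ) :
    Fintype.card V * ‖meanValue x‖ ^ 2 ≤ ∑ v, ‖x v‖ ^ 2 := by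
  rw [sum_norm_sq_eq_add_of_sum_sub_eq_zero x _ (sum_sub_meanValue x)]
  have h3 : 0 ≤ ∑ v, ‖x v - meanValue x‖ ^ 2 := Finset.sum_nonneg fun _ _ => sq_nonneg _
  linarith

/-- Split `U` and `A x` into mean and remainder: only mean times mean and remainder times remainder
survive. The remainder of `U` has mean square `1 - |u|²`, that of `A x` carries a factor `c`, and
Cauchy–Schwarz recombines the two terms. -/
theorem card_mul_norm_meanValue_mul_matVec_sq_le [Nonempty V] {A : Matrix V V ℝ} {c : ℝ}
    (hA : IsMixing A c) (U : V → ℂ) (hU : ∀ v, ‖U v‖ = 1) (x : V → ℂ) :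
    Fintype.card V * ‖meanValue fun v => U v * matVec A x v‖ ^ 2 ≤
      (‖meanValue U‖ ^ 2 + c * (1 - ‖meanValue U‖ ^ 2)) * ∑ v, ‖x v‖ ^ 2 := by
  have hN : (0 : ℝ) < Fintype.card V := by exact_mod_cast Fintype.card_pos
  have hN' : (Fintype.card V : ℂ) ≠ 0 := by exact_mod_cast Fintype.card_ne_zero
  set N : ℝ := (Fintype.card V : ℝ) with hNdef
  set u := meanValue U with hu
  set m := meanValue x with hm
  have h0 := sum_sub_meanValue x
  have h1 := sum_norm_sq_eq_add_of_sum_sub_eq_zero x _ h0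
  have h2 := sum_norm_sq_eq_add_of_sum_sub_eq_zero U _ (sum_sub_meanValue U)
  have h3 := sum_norm_sq_matVec_le_of_sum_eq_zero hA _ h0
  simp_rw [matVec_sub_const hA] at h3
  rw [← hm] at h0 h1 h3
  simp only [hU, one_pow, Finset.sum_const, Finset.card_univ, nsmul_eq_mul, mul_one] at h2
  rw [← hu, ← hNdef] at h2
  rw [← hNdef] at h1
  have hz : ∑ v, (matVec A x v - m) = 0 := by
    simp_rw [← matVec_sub_const hA]
    rw [sum_matVec hA, h0]
  have e : ∑ v, U v * matVec A x v =
      Fintype.card V * (m * u) + ∑ v, (U v - u) * (matVec A x v - m) := by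
    have : ∀ v, (U v - u) * (matVec A x v - m) =
        U v * matVec A x v - m * U v - u * (matVec A x v - m) := fun v => by ring
    simp_rw [this, Finset.sum_sub_distrib, ← Finset.mul_sum, hz]
    have : ∑ v, U v = Fintype.card V * u := by
      rw [hu, meanValue]; field_simp
    rw [this]; ring
  have h4 := norm_sum_mul_sq_le (fun v => U v - u) (fun v => matVec A x v - m)
  set S := ‖∑ v, (U v - u) * (matVec A x v - m)‖ with hS
  set Y := ∑ v, ‖x v - m‖ ^ 2 with hY
  have hY0 : 0 ≤ Y := Finset.sum_nonneg fun _ _ => sq_nonneg _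
  have hS0 : 0 ≤ S := norm_nonneg _
  have hW : 0 ≤ ∑ v, ‖U v - u‖ ^ 2 := Finset.sum_nonneg fun _ _ => sq_nonneg _
  have h5 : ‖∑ v, U v * matVec A x v‖ ≤ N * (‖m‖ * ‖u‖) + S := by
    rw [e]
    refine (norm_add_le _ _).trans (le_of_eq ?_)
    rw [norm_mul, norm_mul, Complex.norm_natCast]
  set a := ‖u‖ with ha
  set b := ‖m‖ with hb
  have ha0 : 0 ≤ a := norm_nonneg _
  have hb0 : 0 ≤ b := norm_nonneg _
  have h6 : ∑ v, ‖U v - u‖ ^ 2 = N * (1 - a ^ 2) := by linarith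
  rw [h6] at h4 hW
  have ha1 : 0 ≤ 1 - a ^ 2 := nonneg_of_mul_nonneg_right hW hN
  set q := c * (1 - a ^ 2) with hq
  have hq0 : 0 ≤ q := mul_nonneg hA.nonneg ha1
  have h7 : S ^ 2 ≤ N * q * Y := by
    refine h4.trans ((mul_le_mul_of_nonneg_left h3 hW).trans (le_of_eq ?_))
    rw [hq]; ring
  -- The cross term by AM–GM, in squared form to avoid square roots.
  have h8 : 2 * (N * (b * a)) * S ≤ N * a ^ 2 * Y + N ^ 2 * q * b ^ 2 := by
    refine le_of_sq_le_sq ?_ (by positivity)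
    calc (2 * (N * (b * a)) * S) ^ 2 = 4 * (N * (b * a)) ^ 2 * S ^ 2 := by ring
      _ ≤ 4 * (N * (b * a)) ^ 2 * (N * q * Y) := by gcongr
      _ ≤ _ := by nlinarith [sq_nonneg (N * a ^ 2 * Y - N ^ 2 * q * b ^ 2)]
  have h9 := pow_le_pow_left₀ (norm_nonneg _) h5 2
  have h10 : N * ‖meanValue fun v => U v * matVec A x v‖ ^ 2 =
      ‖∑ v, U v * matVec A x v‖ ^ 2 / N := by
    rw [meanValue, norm_div, Complex.norm_natCast, ← hNdef]
    field_simp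
  rw [h10, div_le_iff₀ hN, h1]
  nlinarith

/-- Two steps with a phase of mean `u` in between. -/
theorem sum_norm_sq_matVec_mul_matVec_le [Nonempty V] {A : Matrix V V ℝ} {c : ℝ} (hA : IsMixing A c)
    (U : V → ℂ) (hU : ∀ v, ‖U v‖ = 1) (x : V → ℂ) :
    ∑ v, ‖matVec A (fun w => U w * matVec A x w) v‖ ^ 2 ≤
      (1 - (1 - c) ^ 2 * (1 - ‖meanValue U‖ ^ 2)) * ∑ v, ‖x v‖ ^ 2 := by
  have h1 := sum_norm_sq_matVec_le hA (fun w => U w * matVec A x w)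
  have h2 := card_mul_norm_meanValue_mul_matVec_sq_le hA U hU x
  have h3 := sum_norm_sq_matVec_le_self hA x
  simp only [norm_mul, hU, one_mul] at h1
  have h4 := mul_le_mul_of_nonneg_left h3 hA.nonneg
  have h5 := mul_le_mul_of_nonneg_left h2 (sub_nonneg.2 hA.le_one)
  nlinarith

/-- `walkVec A U m v` is the sum over walks `v = w₀, …, w_m` of the products of the phases
`U i (w i)`, weighted by the transition probabilities. -/
noncomputable def walkVec (A : Matrix V V ℝ) : ℕ → (ℕ → V → ℂ) → V → ℂ
  | 0, U => U 0
  | m + 1, U => fun v => U 0 v * matVec A (walkVec A m fun i => U (i + 1)) v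

theorem walkVec_succ_le [Nonempty V] {A : Matrix V V ℝ} {c : ℝ} (hA : IsMixing A c) (U : ℕ → V → ℂ)
    (hU : ∀ i v, ‖U i v‖ = 1) (m : ℕ) :
    ∑ v, ‖walkVec A (m + 1) U v‖ ^ 2 ≤ ∑ v, ‖walkVec A m (fun i => U (i + 1)) v‖ ^ 2 := by
  simp only [walkVec, norm_mul, hU, one_mul]
  exact sum_norm_sq_matVec_le_self hA _

/-- The two-step bound skips every other phase. Multiplying the squared norms of consecutive vectors
lets each interior phase contribute exactly once; the two end phases are lost. -/
theorem sum_norm_sq_walkVec_mul_le [Nonempty V] {A : Matrix V V ℝ} {c : ℝ} (hA : IsMixing A c)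
    (m : ℕ) (U : ℕ → V → ℂ) (hU : ∀ i v, ‖U i v‖ = 1) :
    (∑ v, ‖walkVec A (m + 1) U v‖ ^ 2) * ∑ v, ‖walkVec A m (fun i => U (i + 1)) v‖ ^ 2 ≤
      (Fintype.card V : ℝ) ^ 2 *
        ∏ i ∈ range m, (1 - (1 - c) ^ 2 * (1 - ‖meanValue (U (i + 1))‖ ^ 2)) := by
  induction m generalizing U with
  | zero =>
    have h1 := walkVec_succ_le hA U hU 0
    have h2 : ∑ v, ‖walkVec A 0 (fun i => U (i + 1)) v‖ ^ 2 = Fintype.card V := by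
      simp [walkVec, hU]
    rw [h2] at h1 ⊢
    simp only [range_zero, prod_empty, mul_one, sq (Fintype.card V : ℝ)]
    exact mul_le_mul_of_nonneg_right h1 (Nat.cast_nonneg _)
  | succ m ih =>
    have h1 := ih (fun i => U (i + 1)) (fun i => hU (i + 1))
    have h2 := sum_norm_sq_matVec_mul_matVec_le hA (U 1) (hU 1) (walkVec A m fun i => U (i + 2))
    have hmu : ‖meanValue (U 1)‖ ^ 2 ≤ 1 := by
      have hN : (0 : ℝ) < Fintype.card V := by exact_mod_cast Fintype.card_pos
      have := card_mul_norm_meanValue_sq_le (U 1)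
      simp only [hU, one_pow, Finset.sum_const, Finset.card_univ, nsmul_eq_mul] at this
      exact le_of_mul_le_mul_left this hN
    have hr : 0 ≤ 1 - (1 - c) ^ 2 * (1 - ‖meanValue (U 1)‖ ^ 2) := by
      have := hA.nonneg
      have := hA.le_one
      have : (1 - c) ^ 2 ≤ 1 := by nlinarith
      nlinarith [sq_nonneg ‖meanValue (U 1)‖, sq_nonneg (1 - c)]
    have h3 : ∑ v, ‖walkVec A (m + 2) U v‖ ^ 2 ≤
        (1 - (1 - c) ^ 2 * (1 - ‖meanValue (U 1)‖ ^ 2)) *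
          ∑ v, ‖walkVec A m (fun i => U (i + 2)) v‖ ^ 2 := by
      simp only [walkVec, norm_mul, hU, one_mul]
      simpa only [zero_add] using h2
    rw [Finset.prod_range_succ']
    have h4 : 0 ≤ ∑ v, ‖walkVec A (m + 1) (fun i => U (i + 1)) v‖ ^ 2 :=
      Finset.sum_nonneg fun _ _ => sq_nonneg _
    refine (mul_le_mul_of_nonneg_right h3 h4).trans ?_
    have h5 := mul_le_mul_of_nonneg_left h1 hr
    refine le_trans (le_of_eq ?_) (h5.trans (le_of_eq ?_))
    · ring
    · simp only [zero_add]; ring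

/-- Both factors of the preceding product dominate `N ‖mean‖²`, hence the fourth power. -/
theorem norm_meanValue_walkVec_le [Nonempty V] {A : Matrix V V ℝ} {c : ℝ} (hA : IsMixing A c)
    (m : ℕ) (U : ℕ → V → ℂ) (hU : ∀ i v, ‖U i v‖ = 1) :
    ‖meanValue (walkVec A (m + 1) U)‖ ^ 4 ≤
      ∏ i ∈ range m, (1 - (1 - c) ^ 2 * (1 - ‖meanValue (U (i + 1))‖ ^ 2)) := by
  have hN : (0 : ℝ) < Fintype.card V := by exact_mod_cast Fintype.card_pos
  have h1 := sum_norm_sq_walkVec_mul_le hA m U hU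
  have h2 := walkVec_succ_le hA U hU m
  have h3 := card_mul_norm_meanValue_sq_le (walkVec A (m + 1) U)
  have h4 : (Fintype.card V * ‖meanValue (walkVec A (m + 1) U)‖ ^ 2) ^ 2 ≤ _ :=
    (sq _).trans_le ((mul_le_mul h3 (h3.trans h2) (by positivity)
      (Finset.sum_nonneg fun _ _ => sq_nonneg _)).trans h1)
  rw [mul_pow, ← pow_mul] at h4
  exact le_of_mul_le_mul_left h4 (by positivity)

theorem walkVec_eq_sum (A : Matrix V V ℝ) (m : ℕ) (U : ℕ → V → ℂ) (v : V) :
    walkVec A m U v = ∑ w : Fin m → V,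
      (∏ i : Fin (m + 1), U i ((Fin.cons v w : Fin (m + 1) → V) i)) *
      ∏ i : Fin m, (A ((Fin.cons v w : Fin (m + 1) → V) i.castSucc) (w i) : ℂ) := by
  induction m generalizing U v with
  | zero => simp [walkVec]
  | succ m ih =>
    simp only [walkVec, matVec]
    rw [← (Fin.consEquiv fun _ => V).sum_comp, Fintype.sum_prod_type, Finset.mul_sum]
    refine Finset.sum_congr rfl fun v' _ => ?_
    rw [ih, Finset.mul_sum, Finset.mul_sum]
    refine Finset.sum_congr rfl fun w _ => ?_
    rw [Fin.prod_univ_succ (n := m + 1), Fin.prod_univ_succ (n := m)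
      (f := fun i => (A _ _ : ℂ))]
    simp only [Fin.consEquiv_apply, Fin.cons_zero, Fin.cons_succ, Fin.val_zero, Fin.val_succ,
      Fin.castSucc_zero, Fin.castSucc_succ]
    ring

theorem sum_walkVec (A : Matrix V V ℝ) (m : ℕ) (U : ℕ → V → ℂ) :
    ∑ v, walkVec A m U v = ∑ w : Fin (m + 1) → V, (∏ i : Fin (m + 1), U i (w i)) *
      ∏ i : Fin m, (A (w i.castSucc) (w i.succ) : ℂ) := by
  rw [← (Fin.consEquiv fun _ => V).sum_comp, Fintype.sum_prod_type]
  refine Finset.sum_congr rfl fun v _ => ?_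
  rw [walkVec_eq_sum]
  simp [Fin.consEquiv_apply]

end WalkOperator

/-! ### Integral estimates and Esseen's inequality -/

section Analysis

/-- Jensen for `exp`; it takes the place of Hölder's inequality for the integral of a product. -/
theorem exp_sum_le_average {ι : Type*} (s : Finset ι) (hs : s.Nonempty) (a : ι → ℝ) :
    Real.exp (∑ i ∈ s, a i) ≤ (∑ i ∈ s, Real.exp (s.card * a i)) / s.card := by
  have hc : (s.card : ℝ) ≠ 0 := by exact_mod_cast hs.card_pos.ne'
  have h := convexOn_exp.map_sum_le (t := s) (w := fun _ => (s.card : ℝ)⁻¹)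
    (p := fun i => s.card * a i) (fun _ _ => by positivity)
    (by simp [hc]) (fun _ _ => Set.mem_univ _)
  simp only [smul_eq_mul, inv_mul_cancel_left₀ hc, ← Finset.mul_sum] at h
  rwa [div_eq_inv_mul]

/-- On the period centred at 0, `|sin u| ≥ 2|u|/π` reduces this to a Gaussian integral; the constant
3 amounts to `π³ ≤ 36`. -/
theorem integral_exp_neg_mul_sin_sq_le {β : ℝ} (hβ : 0 < β) :
    ∫ u in (0 : ℝ)..Real.pi, Real.exp (-(β * Real.sin u ^ 2)) ≤ 3 / √β := by
  have hpi := Real.pi_pos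
  have hper : Function.Periodic (fun u => Real.exp (-(β * Real.sin u ^ 2))) Real.pi := by
    intro u; simp [Real.sin_add_pi]
  have h1 := hper.intervalIntegral_add_eq 0 (-(Real.pi / 2))
  rw [zero_add, show -(Real.pi / 2) + Real.pi = Real.pi / 2 by ring] at h1
  rw [h1]
  set b : ℝ := β * (2 / Real.pi) ^ 2 with hb
  have hbpos : 0 < b := by positivity
  have hint : MeasureTheory.Integrable fun u : ℝ => Real.exp (-b * u ^ 2) :=
    integrable_exp_neg_mul_sq hbpos
  have h2 : ∫ u in (-(Real.pi / 2))..(Real.pi / 2), Real.exp (-(β * Real.sin u ^ 2)) ≤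
      ∫ u in (-(Real.pi / 2))..(Real.pi / 2), Real.exp (-b * u ^ 2) := by
    apply intervalIntegral.integral_mono_on (by linarith)
    · exact Continuous.intervalIntegrable (by fun_prop) _ _
    · exact Continuous.intervalIntegrable (by fun_prop) _ _
    · intro u hu
      apply Real.exp_le_exp.2
      have h3 : 2 / Real.pi * |u| ≤ |Real.sin u| :=
        Real.mul_abs_le_abs_sin (abs_le.2 ⟨by linarith [hu.1], hu.2⟩)
      have h4 := pow_le_pow_left₀ (by positivity) h3 2
      rw [mul_pow, sq_abs, sq_abs] at h4
      rw [hb]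
      nlinarith
  have h3 : ∫ u in (-(Real.pi / 2))..(Real.pi / 2), Real.exp (-b * u ^ 2) ≤
      ∫ u : ℝ, Real.exp (-b * u ^ 2) := by
    rw [intervalIntegral.integral_of_le (by linarith)]
    exact MeasureTheory.setIntegral_le_integral hint
      (Filter.Eventually.of_forall fun u => (Real.exp_pos _).le)
  rw [integral_gaussian] at h3
  refine (h2.trans h3).trans ?_
  rw [show (3 : ℝ) / √β = √(9 / β) by
    rw [Real.sqrt_div (by norm_num), show (9 : ℝ) = 3 ^ 2 by norm_num, Real.sqrt_sq (by norm_num)]]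
  apply Real.sqrt_le_sqrt
  rw [hb, div_le_div_iff₀ (by positivity) hβ]
  have h5 : Real.pi ^ 3 ≤ 36 := by
    have := Real.pi_lt_d2
    calc Real.pi ^ 3 ≤ 3.15 ^ 3 := by gcongr
      _ ≤ 36 := by norm_num
  have : Real.pi * Real.pi ^ 2 ≤ 36 := by nlinarith
  calc Real.pi * β = β * (Real.pi * Real.pi ^ 2) / Real.pi ^ 2 := by field_simp
    _ ≤ β * 36 / Real.pi ^ 2 := by gcongr
    _ = _ := by field_simp; ring

/-- The substitution `u = (t - s) v` covers an interval of length `v`, that is, at most `⌈v/π⌉ ≤ 2v`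
periods because `v ≥ 1`; the Jacobian `1/v` cancels this. -/
theorem integral_exp_neg_mul_sin_mul_sq_le {β v : ℝ} (hβ : 0 < β) (hv : 1 ≤ v) (s : ℝ) :
    ∫ t in (0 : ℝ)..1, Real.exp (-(β * Real.sin ((t - s) * v) ^ 2)) ≤ 6 / √β := by
  have hpi := Real.pi_pos
  have hv0 : v ≠ 0 := by linarith
  set g : ℝ → ℝ := fun u => Real.exp (-(β * Real.sin u ^ 2)) with hg
  have hper : Function.Periodic g Real.pi := by
    intro u; simp [hg, Real.sin_add_pi]
  have hcont : Continuous g := by fun_prop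
  have e1 : ∫ t in (0 : ℝ)..1, Real.exp (-(β * Real.sin ((t - s) * v) ^ 2)) =
      v⁻¹ * ∫ u in (-(v * s))..(v - v * s), g u := by
    have := intervalIntegral.integral_comp_mul_sub (a := 0) (b := 1) g hv0 (v * s)
    simp only [mul_zero, zero_sub, mul_one, smul_eq_mul] at this
    rw [← this]
    congr 1
    ext t
    simp only [hg]
    congr 5
    ring
  set n : ℕ := ⌈v / Real.pi⌉₊ with hn
  have hn1 : v ≤ n * Real.pi := by
    rw [← div_le_iff₀ hpi]; exact Nat.le_ceil _
  have hn2 : (n : ℝ) ≤ 2 * v := by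
    have h1 := Nat.ceil_lt_add_one (a := v / Real.pi) (by positivity)
    have h2 : v / Real.pi ≤ v := div_le_self (by linarith) (by linarith [Real.pi_gt_three])
    linarith
  have e2 : ∫ u in (-(v * s))..(v - v * s), g u ≤
      ∫ u in (-(v * s))..(-(v * s) + (n : ℤ) • Real.pi), g u := by
    apply intervalIntegral.integral_mono_interval le_rfl (by linarith)
    · simp only [zsmul_eq_mul, Int.cast_natCast]; linarith
    · exact Filter.Eventually.of_forall fun u => (Real.exp_pos _).le
    · exact hcont.intervalIntegrable _ _
  rw [hper.intervalIntegral_add_zsmul_eq n _ (fun _ _ => hcont.intervalIntegrable _ _)] at e2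
  simp only [zsmul_eq_mul, Int.cast_natCast] at e2
  have e3 := hper.intervalIntegral_add_eq (-(v * s)) 0
  rw [zero_add] at e3
  rw [e3] at e2
  have e4 := integral_exp_neg_mul_sin_sq_le hβ
  have hs : 0 < √β := Real.sqrt_pos.2 hβ
  rw [e1]
  calc v⁻¹ * ∫ u in (-(v * s))..(v - v * s), g u ≤ v⁻¹ * (n * (3 / √β)) := by
        apply mul_le_mul_of_nonneg_left _ (by positivity)
        exact e2.trans (mul_le_mul_of_nonneg_left e4 (Nat.cast_nonneg _))
    _ ≤ v⁻¹ * (2 * v * (3 / √β)) := by gcongr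
    _ = 6 / √β := by field_simp; norm_num

/-- The double integral is `|∫₀¹ exp(itx) dt|²`: a nonnegative kernel whose Fourier data live at the
frequencies `t - s`. -/
theorem integral_integral_cos_nonneg (x : ℝ) :
    0 ≤ ∫ s in (0 : ℝ)..1, ∫ t in (0 : ℝ)..1, Real.cos ((t - s) * x) := by
  have h : ∀ s : ℝ, ∫ t in (0 : ℝ)..1, Real.cos ((t - s) * x) =
      (∫ t in (0 : ℝ)..1, Real.cos (t * x)) * Real.cos (s * x) +
        (∫ t in (0 : ℝ)..1, Real.sin (t * x)) * Real.sin (s * x) := by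
    intro s
    simp_rw [sub_mul, Real.cos_sub]
    rw [intervalIntegral.integral_add, intervalIntegral.integral_mul_const,
      intervalIntegral.integral_mul_const]
    · exact Continuous.intervalIntegrable (by fun_prop) _ _
    · exact Continuous.intervalIntegrable (by fun_prop) _ _
  simp_rw [h]
  rw [intervalIntegral.integral_add, intervalIntegral.integral_const_mul,
    intervalIntegral.integral_const_mul]
  · exact add_nonneg (mul_self_nonneg _) (mul_self_nonneg _)
  · exact Continuous.intervalIntegrable (by fun_prop) _ _
  · exact Continuous.intervalIntegrable (by fun_prop) _ _

theorem continuous_integral_cos (x : ℝ) :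
    Continuous fun s : ℝ => ∫ t in (0 : ℝ)..1, Real.cos ((t - s) * x) :=
  intervalIntegral.continuous_parametric_intervalIntegral_of_continuous' (by fun_prop) _ _

theorem half_le_integral_integral_cos {x : ℝ} (hx : |x| ≤ 1) :
    1 / 2 ≤ ∫ s in (0 : ℝ)..1, ∫ t in (0 : ℝ)..1, Real.cos ((t - s) * x) := by
  have h1 : ∀ s ∈ Set.Icc (0 : ℝ) 1, 1 / 2 ≤ ∫ t in (0 : ℝ)..1, Real.cos ((t - s) * x) := by
    intro s hs
    have : ∫ _t in (0 : ℝ)..1, (1 / 2 : ℝ) ≤ ∫ t in (0 : ℝ)..1, Real.cos ((t - s) * x) := by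
      apply intervalIntegral.integral_mono_on (by norm_num)
      · exact Continuous.intervalIntegrable (by fun_prop) _ _
      · exact Continuous.intervalIntegrable (by fun_prop) _ _
      · intro t ht
        have h2 := Real.one_sub_sq_div_two_le_cos (x := (t - s) * x)
        have h3 : |(t - s) * x| ≤ 1 := by
          rw [abs_mul]
          have : |t - s| ≤ 1 := abs_le.2 ⟨by linarith [hs.2, ht.1], by linarith [hs.1, ht.2]⟩
          exact mul_le_one₀ this (abs_nonneg _) hx
        have h4 := (sq_le_one_iff_abs_le_one _).2 h3
        linarith
    simpa using this
  have : ∫ _s in (0 : ℝ)..1, (1 / 2 : ℝ) ≤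
      ∫ s in (0 : ℝ)..1, ∫ t in (0 : ℝ)..1, Real.cos ((t - s) * x) := by
    apply intervalIntegral.integral_mono_on (by norm_num)
    · exact Continuous.intervalIntegrable (by fun_prop) _ _
    · exact (continuous_integral_cos x).intervalIntegrable _ _
    · exact h1
  simpa using this

/-- A form of Esseen's inequality, for the counting measure on a finite set. -/
theorem card_filter_abs_sub_le_of_integral_le {ι : Type*} (W : Finset ι) (Y : ι → ℝ) (x₀ B : ℝ)
    (h : ∀ s : ℝ, ∫ t in (0 : ℝ)..1, ‖∑ w ∈ W, Complex.exp (((t - s) * Y w : ℝ) * Complex.I)‖ ≤ B) :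
    ((W.filter fun w => |Y w - x₀| ≤ 1).card : ℝ) ≤ 2 * B := by
  have h1 : ((W.filter fun w => |Y w - x₀| ≤ 1).card : ℝ) * (1 / 2) ≤
      ∑ w ∈ W, ∫ s in (0 : ℝ)..1, ∫ t in (0 : ℝ)..1, Real.cos ((t - s) * (Y w - x₀)) := by
    rw [← nsmul_eq_mul, ← Finset.sum_const]
    refine (Finset.sum_le_sum fun w hw => half_le_integral_integral_cos
      (Finset.mem_filter.1 hw).2).trans ?_
    exact Finset.sum_le_sum_of_subset_of_nonneg (Finset.filter_subset _ _)
      fun _ _ _ => integral_integral_cos_nonneg _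
  rw [← intervalIntegral.integral_finsetSum
    (fun w _ => (continuous_integral_cos _).intervalIntegrable _ _)] at h1
  have h2 : ‖∫ s in (0 : ℝ)..1, ∑ w ∈ W, ∫ t in (0 : ℝ)..1, Real.cos ((t - s) * (Y w - x₀))‖ ≤
      B * |1 - 0| := by
    apply intervalIntegral.norm_integral_le_of_norm_le_const
    intro s _
    rw [← intervalIntegral.integral_finsetSum
      (fun w _ => Continuous.intervalIntegrable (by fun_prop) _ _)]
    refine (intervalIntegral.norm_integral_le_integral_norm (by norm_num)).trans
      (le_trans ?_ (h s))
    apply intervalIntegral.integral_mono_on (by norm_num)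
    · exact Continuous.intervalIntegrable (by fun_prop) _ _
    · exact Continuous.intervalIntegrable (by fun_prop) _ _
    · intro t _
      have e : ∑ w ∈ W, Real.cos ((t - s) * (Y w - x₀)) =
          (Complex.exp ((-((t - s) * x₀) : ℝ) * Complex.I) *
            ∑ w ∈ W, Complex.exp (((t - s) * Y w : ℝ) * Complex.I)).re := by
        rw [Finset.mul_sum, Complex.re_sum]
        refine Finset.sum_congr rfl fun w _ => ?_
        rw [← Complex.exp_add, ← add_mul, ← Complex.ofReal_add, Complex.exp_ofReal_mul_I_re]
        congr 1; ring
      rw [e]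
      refine (Complex.abs_re_le_norm _).trans (le_of_eq ?_)
      rw [norm_mul, Complex.norm_exp_ofReal_mul_I, one_mul]
  rw [Real.norm_eq_abs] at h2
  have := (le_abs_self _).trans h2
  simp only [sub_zero, abs_one, mul_one] at this
  linarith

/-- The mean of a phase with independent uniform signs. -/
theorem meanValue_exp_signs {k : ℕ} (v : Fin k → ℝ) (τ : ℝ) :
    meanValue (fun w : Fin k → ℤˣ =>
      Complex.exp ((τ * ∑ l, ((w l : ℤ) : ℝ) * v l : ℝ) * Complex.I)) =
      ((∏ l, Real.cos (τ * v l) : ℝ) : ℂ) := by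
  have h1 : ∀ w : Fin k → ℤˣ, Complex.exp ((τ * ∑ l, ((w l : ℤ) : ℝ) * v l : ℝ) * Complex.I) =
      ∏ l, Complex.exp ((τ * (((w l : ℤ) : ℝ) * v l) : ℝ) * Complex.I) := by
    intro w
    rw [← Complex.exp_sum, ← Finset.sum_mul, ← Complex.ofReal_sum, Finset.mul_sum]
  have h2 : ∀ l, ∑ s : ℤˣ, Complex.exp ((τ * (((s : ℤ) : ℝ) * v l) : ℝ) * Complex.I) =
      2 * (Real.cos (τ * v l) : ℂ) := by
    intro l
    rw [show (univ : Finset ℤˣ) = {1, -1} from rfl, Finset.sum_pair (by decide)]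
    rw [Complex.ofReal_cos, Complex.two_cos]
    simp
  rw [meanValue]
  simp_rw [h1]
  rw [← Fintype.piFinset_univ, ← Finset.prod_univ_sum (fun _ => univ)
    (fun l (s : ℤˣ) => Complex.exp ((τ * (((s : ℤ) : ℝ) * v l) : ℝ) * Complex.I))]
  simp_rw [h2]
  rw [Finset.prod_mul_distrib, Finset.prod_const]
  simp

/-- Through `exp(-s) ≤ 1/(1 + s) ≤ 1 - min(s, 1)/2`. The cap at 1 is unavoidable: even a phase of
mean zero gains only a constant factor. -/
theorem one_sub_mul_le_exp {γ s a : ℝ} (hγ : 0 ≤ γ) (hs : 0 ≤ s) (ha : a ≤ Real.exp (-s)) :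
    1 - γ * (1 - a) ≤ Real.exp (-(γ / 2 * min s 1)) := by
  have h1 : Real.exp (-s) ≤ 1 / (1 + s) := by
    rw [Real.exp_neg, one_div]
    exact inv_anti₀ (by linarith) (by linarith [Real.add_one_le_exp s])
  have h2 : 1 / (1 + s) ≤ 1 - min s 1 / 2 := by
    rw [div_le_iff₀ (by linarith)]
    rcases le_total s 1 with h | h
    · rw [min_eq_left h]; nlinarith
    · rw [min_eq_right h]; nlinarith
  have h3 := Real.add_one_le_exp (-(γ / 2 * min s 1))
  nlinarith

end Analysis

/-! ### Walks as tuples, and expanders as mixing matrices -/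

section Walks

theorem exists_walk_getVert {V : Type*} {G : SimpleGraph V} (m : ℕ) (w : ℕ → V)
    (h : ∀ i < m, G.Adj (w i) (w (i + 1))) :
    ∃ p : G.Walk (w 0) (w m), p.length = m ∧ ∀ j ≤ m, p.getVert j = w j := by
  induction m generalizing w with
  | zero => exact ⟨.nil, rfl, fun j hj => by simp [Nat.le_zero.1 hj]⟩
  | succ m ih =>
    obtain ⟨p, hp, hp'⟩ := ih (fun i => w (i + 1)) fun i hi => h (i + 1) (by omega)
    refine ⟨.cons (h 0 (by omega)) p, by simp [hp], fun j hj => ?_⟩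
    cases j with
    | zero => simp
    | succ j => simpa using hp' j (by omega)

/-- The `L`-tuples of vertices in which consecutive vertices are adjacent. -/
noncomputable def walkTuples {V : Type*} [Fintype V] (G : SimpleGraph V) (L : ℕ) :
    Finset (Fin L → V) :=
  open Classical in
  univ.filter fun w => ∀ (j : ℕ) (h : j + 1 < L), G.Adj (w ⟨j, by omega⟩) (w ⟨j + 1, h⟩)

variable {V : Type*} [Fintype V]

theorem mem_walkTuples_succ {G : SimpleGraph V} {m : ℕ} {w : Fin (m + 1) → V} :
    w ∈ walkTuples G (m + 1) ↔ ∀ i : Fin m, G.Adj (w i.castSucc) (w i.succ) := by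
  simp only [walkTuples, mem_filter, mem_univ, true_and]
  constructor
  · intro h i
    exact h i (by omega)
  · intro h j hj
    exact h ⟨j, by omega⟩

theorem sum_normAdj {G : SimpleGraph V} {d : ℕ} (hd : d ≠ 0)
    (hreg : ∀ v, {w | G.Adj v w}.ncard = d) (v : V) : ∑ w, normAdj G d v w = 1 := by
  classical
  have h := hreg v
  rw [← Finset.coe_filter_univ, Set.ncard_coe_finset] at h
  simp only [normAdj, Matrix.of_apply]
  rw [← Finset.sum_filter, Finset.sum_const, h, nsmul_eq_mul]
  have : (d : ℝ) ≠ 0 := by exact_mod_cast hd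
  field_simp

theorem l2Norm_const [Nonempty V] (a : ℝ) : l2Norm (fun _ : V => a) = |a| := by
  have hN : (Fintype.card V : ℝ) ≠ 0 := by exact_mod_cast Fintype.card_ne_zero
  rw [l2Norm, Finset.sum_const, Finset.card_univ, nsmul_eq_mul, ← Real.sqrt_sq_eq_abs]
  congr 1
  field_simp

theorem IsSpectralExpander.nonneg [Nonempty V] {G : SimpleGraph V} {d : ℕ} {lam : ℝ}
    (hG : IsSpectralExpander G d lam) : 0 ≤ lam := by
  have h := hG.norm_le fun _ => 1
  rw [l2Norm_const, abs_one, mul_one] at h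
  exact (Real.sqrt_nonneg _).trans h

theorem IsSpectralExpander.degree_ne_zero [Nonempty V] {G : SimpleGraph V} {d : ℕ} {lam : ℝ}
    (hG : IsSpectralExpander G d lam) (hlam : lam < 1) : d ≠ 0 := by
  rintro rfl
  have h := hG.norm_le fun _ => 1
  have hN : (Fintype.card V : ℝ) ≠ 0 := by exact_mod_cast Fintype.card_ne_zero
  have e : Matrix.mulVec (normAdj G 0 - avgMatrix V) (fun _ => 1) = fun _ => (-1 : ℝ) := by
    ext v
    rw [normAdj_sub_avgMatrix_mulVec]
    simp [normAdj, Matrix.mulVec, dotProduct, hN]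
  rw [e, l2Norm_const, l2Norm_const] at h
  norm_num at h
  linarith

theorem IsSpectralExpander.isMixing [Nonempty V] {G : SimpleGraph V} {d : ℕ} {lam : ℝ}
    (hG : IsSpectralExpander G d lam) (hlam : lam < 1) : IsMixing (normAdj G d) (lam ^ 2) where
  row_sum := sum_normAdj (hG.degree_ne_zero hlam) hG.regular
  col_sum w := by
    rw [← sum_normAdj (hG.degree_ne_zero hlam) hG.regular w]
    refine Finset.sum_congr rfl fun v _ => ?_
    by_cases h : G.Adj v w
    · simp [normAdj, h, h.symm]
    · simp [normAdj, h, mt G.adj_symm h]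
  contract f hf := by
    refine le_trans (le_of_eq (Finset.sum_congr rfl fun v _ => ?_))
      (sum_sq_le_of_l2Norm_le (hG.norm_le f))
    rw [normAdj_sub_avgMatrix_mulVec, hf, zero_div, sub_zero]
  nonneg := sq_nonneg _
  le_one := by have := hG.nonneg; nlinarith

theorem sum_walkVec_normAdj (G : SimpleGraph V) (d m : ℕ) (U : ℕ → V → ℂ) :
    ∑ v, walkVec (normAdj G d) m U v =
      1 / (d : ℂ) ^ m * ∑ w ∈ walkTuples G (m + 1), ∏ i : Fin (m + 1), U i (w i) := by
  classical
  have e : ∀ w : Fin (m + 1) → V, ∏ i : Fin m, (normAdj G d (w i.castSucc) (w i.succ) : ℂ) =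
      if w ∈ walkTuples G (m + 1) then 1 / (d : ℂ) ^ m else 0 := by
    intro w
    split_ifs with h
    · rw [mem_walkTuples_succ] at h
      simp [normAdj, h]
    · rw [mem_walkTuples_succ] at h
      push Not at h
      obtain ⟨i, hi⟩ := h
      apply Finset.prod_eq_zero (Finset.mem_univ i)
      simp [normAdj, hi]
  rw [sum_walkVec, Finset.mul_sum]
  simp_rw [e, mul_ite, mul_zero]
  rw [← Finset.sum_filter, Finset.filter_mem_eq_inter, Finset.univ_inter]
  exact Finset.sum_congr rfl fun w _ => mul_comm _ _

theorem walkVec_one {A : Matrix V V ℝ} {c : ℝ} (hA : IsMixing A c) (m : ℕ) :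
    walkVec A m (fun _ _ => 1) = fun _ => 1 := by
  induction m with
  | zero => rfl
  | succ m ih =>
    simp only [walkVec, ih, matVec, mul_one, one_mul]
    ext v
    have := hA.row_sum v
    exact_mod_cast this

/-- Trivial phases make the weighted sum over walks a count. -/
theorem card_walkTuples [Nonempty V] {G : SimpleGraph V} {d : ℕ} {lam : ℝ}
    (hG : IsSpectralExpander G d lam) (hlam : lam < 1) (m : ℕ) :
    (walkTuples G (m + 1)).card = Fintype.card V * d ^ m := by
  have h := sum_walkVec_normAdj G d m (fun _ _ => 1)
  have hd : (d : ℂ) ≠ 0 := by exact_mod_cast hG.degree_ne_zero hlam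
  rw [walkVec_one (hG.isMixing hlam)] at h
  simp only [Finset.sum_const, Finset.prod_const_one, Finset.card_univ, nsmul_eq_mul, mul_one] at h
  field_simp at h
  exact_mod_cast h.symm

theorem norm_sum_walkTuples_eq [Nonempty V] {G : SimpleGraph V} {d : ℕ} {lam : ℝ}
    (hG : IsSpectralExpander G d lam) (hlam : lam < 1) (m : ℕ) (U : ℕ → V → ℂ) :
    ‖∑ w ∈ walkTuples G (m + 1), ∏ i : Fin (m + 1), U i (w i)‖ =
      (walkTuples G (m + 1)).card * ‖meanValue (walkVec (normAdj G d) m U)‖ := by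
  have hd : (d : ℂ) ≠ 0 := by exact_mod_cast hG.degree_ne_zero hlam
  have hd' : (d : ℝ) ≠ 0 := by exact_mod_cast hG.degree_ne_zero hlam
  have hN : (Fintype.card V : ℝ) ≠ 0 := by exact_mod_cast Fintype.card_ne_zero
  rw [meanValue, sum_walkVec_normAdj, card_walkTuples hG hlam, norm_div, norm_mul, norm_div,
    norm_pow, Complex.norm_natCast, Complex.norm_natCast, norm_one]
  push_cast
  field_simp

end Walks

/-! ### The characteristic function of a random walk -/

section SmallBall

variable {k : ℕ}

theorem norm_meanValue_walkVec_phase_le {A : Matrix (Fin k → ℤˣ) (Fin k → ℤˣ) ℝ} {c : ℝ}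
    (hA : IsMixing A c) {m : ℕ} (hm : 0 < m) (hk : 0 < k) (v : ℕ → Fin k → ℝ) (τ : ℝ) :
    ‖meanValue (walkVec A (m + 1) fun j w =>
      Complex.exp ((τ * ∑ l, ((w l : ℤ) : ℝ) * v j l : ℝ) * Complex.I))‖ ≤
      Real.exp (-((1 - c) ^ 2 * m / 8)) + ∑ j ∈ range m, ∑ l : Fin k, 1 / ((m : ℝ) * k) *
        Real.exp (-((1 - c) ^ 2 * m * k / 8 * Real.sin (τ * v (j + 1) l) ^ 2)) := by
  have hm' : (0 : ℝ) < m := by exact_mod_cast hm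
  have hk' : (0 : ℝ) < k := by exact_mod_cast hk
  set γ := (1 - c) ^ 2 with hγ
  have hγ0 : 0 ≤ γ := sq_nonneg _
  set s : ℕ → ℝ := fun j => ∑ l, Real.sin (τ * v j l) ^ 2 with hs
  have hs0 : ∀ j, 0 ≤ s j := fun j => Finset.sum_nonneg fun _ _ => sq_nonneg _
  have h1 := norm_meanValue_walkVec_le hA m (fun j w =>
      Complex.exp ((τ * ∑ l, ((w l : ℤ) : ℝ) * v j l : ℝ) * Complex.I))
      (fun _ _ => Complex.norm_exp_ofReal_mul_I _)
  set x := ‖meanValue (walkVec A (m + 1) fun j w =>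
      Complex.exp ((τ * ∑ l, ((w l : ℤ) : ℝ) * v j l : ℝ) * Complex.I))‖ with hx
  simp only [meanValue_exp_signs] at h1
  have hu : ∀ j, ‖((∏ l, Real.cos (τ * v j l) : ℝ) : ℂ)‖ ^ 2 ≤ Real.exp (-s j) := by
    intro j
    rw [Complex.norm_real, Real.norm_eq_abs, sq_abs, ← Finset.prod_pow, hs,
      ← Finset.sum_neg_distrib, Real.exp_sum]
    refine Finset.prod_le_prod (fun _ _ => sq_nonneg _) fun l _ => ?_
    rw [Real.cos_sq']
    linarith [Real.add_one_le_exp (-Real.sin (τ * v j l) ^ 2)]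
  have hu1 : ∀ j, ‖((∏ l, Real.cos (τ * v j l) : ℝ) : ℂ)‖ ^ 2 ≤ 1 := fun j =>
    (hu j).trans (Real.exp_le_one_iff.2 (by linarith [hs0 j]))
  have hγ1 : γ ≤ 1 := by have := hA.nonneg; have := hA.le_one; rw [hγ]; nlinarith
  -- The exponent `γ/2` becomes `γ/8` on taking fourth roots.
  have h2 : x ^ 4 ≤ (Real.exp (∑ j ∈ range m, -(γ / 8 * min (s (j + 1)) 1))) ^ 4 := by
    refine h1.trans ?_
    rw [← Real.exp_nat_mul, Finset.mul_sum, Real.exp_sum]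
    refine Finset.prod_le_prod (fun j _ => ?_) fun j _ => ?_
    · nlinarith [hu1 (j + 1), sq_nonneg ‖((∏ l, Real.cos (τ * v (j + 1) l) : ℝ) : ℂ)‖]
    · refine (one_sub_mul_le_exp hγ0 (hs0 (j + 1)) (hu (j + 1))).trans (le_of_eq ?_)
      congr 1; push_cast; ring
  have h3 := le_of_pow_le_pow_left₀ (by norm_num) (Real.exp_pos _).le h2
  refine h3.trans ((exp_sum_le_average (range m) (by simpa using hm.ne') _).trans ?_)
  rw [card_range]
  -- If the minimum is 1, the term is the exponential error; otherwise Jensen over the `k` letters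
  -- puts the full factor `m k` in front of a single sine.
  have h4 : ∀ j, Real.exp (m * -(γ / 8 * min (s (j + 1)) 1)) ≤ Real.exp (-(γ * m / 8)) +
      ∑ l : Fin k, 1 / (k : ℝ) * Real.exp (-(γ * m * k / 8 * Real.sin (τ * v (j + 1) l) ^ 2)) := by
    intro j
    have hne : (univ : Finset (Fin k)).Nonempty := ⟨⟨0, hk⟩, Finset.mem_univ _⟩
    rcases le_total (s (j + 1)) 1 with h | h
    · rw [min_eq_left h]
      have h5 := exp_sum_le_average (univ : Finset (Fin k)) hne
        fun l => -(γ * m / 8 * Real.sin (τ * v (j + 1) l) ^ 2)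
      rw [Finset.sum_neg_distrib, ← Finset.mul_sum, Finset.card_univ, Fintype.card_fin] at h5
      refine le_add_of_nonneg_of_le (Real.exp_pos _).le
        ((le_of_eq ?_).trans (h5.trans (le_of_eq ?_)))
      · congr 1; simp only [hs]; ring
      · rw [← Finset.mul_sum, div_eq_inv_mul, one_div]
        congr 1
        refine Finset.sum_congr rfl fun l _ => ?_
        congr 1; ring
    · rw [min_eq_right h]
      refine le_add_of_le_of_nonneg (le_of_eq ?_) (Finset.sum_nonneg fun _ _ => by positivity)
      congr 1; ring
  rw [div_le_iff₀ hm']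
  refine (Finset.sum_le_sum fun j _ => h4 j).trans (le_of_eq ?_)
  rw [Finset.sum_add_distrib, Finset.sum_const, card_range, nsmul_eq_mul, add_mul, Finset.sum_mul,
    mul_comm (m : ℝ)]
  congr 1
  refine Finset.sum_congr rfl fun j _ => ?_
  rw [Finset.sum_mul]
  refine Finset.sum_congr rfl fun l _ => ?_
  field_simp

/-- The Littlewood–Offord bound for the walks on an expander with vertex set `{-1,1}ᵏ`. -/
theorem card_walkTuples_filter_le {G : SimpleGraph (Fin k → ℤˣ)} {d : ℕ} {lam : ℝ}
    (hG : IsSpectralExpander G d lam) (hlam : lam < 1) {m : ℕ} (hm : 0 < m) (hk : 0 < k)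
    (v : ℕ → Fin k → ℝ) (hv : ∀ j l, 1 ≤ v j l) (x₀ : ℝ) :
    (((walkTuples G (m + 2)).filter fun w =>
      |∑ j : Fin (m + 2), ∑ l, ((w j l : ℤ) : ℝ) * v j l - x₀| ≤ 1).card : ℝ) ≤
      2 * ((walkTuples G (m + 2)).card * (8 / ((1 - lam ^ 2) ^ 2 * m) +
        6 / √((1 - lam ^ 2) ^ 2 * m * k / 8))) := by
  have hm' : (0 : ℝ) < m := by exact_mod_cast hm
  have hk' : (0 : ℝ) < k := by exact_mod_cast hk
  have hγ : 0 < (1 - lam ^ 2) ^ 2 := by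
    have := hG.nonneg
    have : 0 < 1 - lam ^ 2 := by nlinarith
    positivity
  set γ := (1 - lam ^ 2) ^ 2 with hγdef
  set β := γ * m * k / 8 with hβ
  have hβ0 : 0 < β := by positivity
  apply card_filter_abs_sub_le_of_integral_le
  intro s
  have h1 : ∀ τ : ℝ, ‖∑ w ∈ walkTuples G (m + 2), Complex.exp
      ((τ * ∑ j : Fin (m + 2), ∑ l, ((w j l : ℤ) : ℝ) * v j l : ℝ) * Complex.I)‖ ≤
      (walkTuples G (m + 2)).card * (Real.exp (-(γ * m / 8)) + ∑ j ∈ range m, ∑ l : Fin k,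
        1 / ((m : ℝ) * k) * Real.exp (-(β * Real.sin (τ * v (j + 1) l) ^ 2))) := by
    intro τ
    refine le_trans (le_of_eq ?_) (mul_le_mul_of_nonneg_left
      (norm_meanValue_walkVec_phase_le (hG.isMixing hlam) hm hk v τ) (Nat.cast_nonneg _))
    rw [← norm_sum_walkTuples_eq hG hlam]
    congr 1
    refine Finset.sum_congr rfl fun w _ => ?_
    rw [← Complex.exp_sum, ← Finset.sum_mul, ← Complex.ofReal_sum, Finset.mul_sum]
  have h2 : ∫ t in (0 : ℝ)..1, ‖∑ w ∈ walkTuples G (m + 2), Complex.exp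
      (((t - s) * ∑ j : Fin (m + 2), ∑ l, ((w j l : ℤ) : ℝ) * v j l : ℝ) * Complex.I)‖ ≤
      ∫ t in (0 : ℝ)..1, (walkTuples G (m + 2)).card * (Real.exp (-(γ * m / 8)) +
        ∑ j ∈ range m, ∑ l : Fin k,
          1 / ((m : ℝ) * k) * Real.exp (-(β * Real.sin ((t - s) * v (j + 1) l) ^ 2))) := by
    apply intervalIntegral.integral_mono_on (by norm_num)
    · exact Continuous.intervalIntegrable (by fun_prop) _ _
    · exact Continuous.intervalIntegrable (by fun_prop) _ _
    · intro t _; exact h1 (t - s)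
  refine h2.trans ?_
  rw [intervalIntegral.integral_const_mul]
  apply mul_le_mul_of_nonneg_left _ (Nat.cast_nonneg _)
  rw [intervalIntegral.integral_add (Continuous.intervalIntegrable (by fun_prop) _ _)
    (Continuous.intervalIntegrable (by fun_prop) _ _), intervalIntegral.integral_const,
    intervalIntegral.integral_finsetSum
      (fun _ _ => Continuous.intervalIntegrable (by fun_prop) _ _)]
  simp only [sub_zero, smul_eq_mul, one_mul]
  refine add_le_add ?_ ?_
  · rw [Real.exp_neg, ← inv_div (γ * m) 8]
    exact inv_anti₀ (by positivity) (by linarith [Real.add_one_le_exp (γ * m / 8)])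
  · have h3 : ∀ j ∈ range m, ∫ t in (0 : ℝ)..1, ∑ l : Fin k,
        1 / ((m : ℝ) * k) * Real.exp (-(β * Real.sin ((t - s) * v (j + 1) l) ^ 2)) ≤
        ∑ _l : Fin k, 1 / ((m : ℝ) * k) * (6 / √β) := by
      intro j _
      rw [intervalIntegral.integral_finsetSum
        (fun _ _ => Continuous.intervalIntegrable (by fun_prop) _ _)]
      refine Finset.sum_le_sum fun l _ => ?_
      rw [intervalIntegral.integral_const_mul]
      exact mul_le_mul_of_nonneg_left (integral_exp_neg_mul_sin_mul_sq_le hβ0 (hv _ _) s)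
        (by positivity)
    refine (Finset.sum_le_sum h3).trans (le_of_eq ?_)
    simp only [Finset.sum_const, card_range, Finset.card_univ, Fintype.card_fin, nsmul_eq_mul]
    field_simp

end SmallBall

/-! ### Block decomposition and small cases -/

section Splitting

theorem sqrt_mul_sqrt_add_sub (n : ℕ) : n.sqrt * n.sqrt + (n - n.sqrt * n.sqrt) = n := by
  have := Nat.sqrt_le n; omega

/-- The coordinates of `{-1,1}ⁿ`, as `k` blocks of length `k = ⌊√n⌋` and a remainder. -/
def blockEquiv (n : ℕ) :
    (Fin n.sqrt × Fin n.sqrt) ⊕ Fin (n - n.sqrt * n.sqrt) ≃ Fin n :=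
  (finProdFinEquiv.sumCongr (Equiv.refl _)).trans
    (finSumFinEquiv.trans (finCongr (sqrt_mul_sqrt_add_sub n)))

theorem blockEquiv_inl_val (n : ℕ) (j l : Fin n.sqrt) :
    (blockEquiv n (Sum.inl (j, l)) : ℕ) = j * n.sqrt + l := by
  simp [blockEquiv, finProdFinEquiv]; ring

/-- A sign vector as a tuple of words and a remainder. -/
def signsEquiv (n : ℕ) : (Fin n → ℤˣ) ≃
    (Fin n.sqrt → Fin n.sqrt → ℤˣ) × (Fin (n - n.sqrt * n.sqrt) → ℤˣ) :=
  (((blockEquiv n).arrowCongr (Equiv.refl _)).symm.trans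
    (Equiv.sumArrowEquivProdArrow _ _ _)).trans ((Equiv.curry _ _ _).prodCongr (Equiv.refl _))

theorem signsEquiv_fst (n : ℕ) (ε : Fin n → ℤˣ) (j l : Fin n.sqrt) :
    (signsEquiv n ε).1 j l = ε (blockEquiv n (Sum.inl (j, l))) := rfl

theorem mem_walkSet_iff {n : ℕ} (hn : 1 ≤ n) (G : SimpleGraph (Fin n.sqrt → ℤˣ))
    (ε : Fin n → ℤˣ) : ε ∈ walkSet n G ↔ (signsEquiv n ε).1 ∈ walkTuples G n.sqrt := by
  have hk : 0 < n.sqrt := Nat.sqrt_pos.2 hn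
  simp only [walkSet, walkTuples, mem_filter, mem_univ, true_and]
  constructor
  · rintro ⟨u, v, p, hp, h⟩ j hj
    have e : ∀ (i : ℕ) (hi : i < n.sqrt), (signsEquiv n ε).1 ⟨i, hi⟩ = p.getVert i := by
      intro i hi
      ext l
      rw [signsEquiv_fst, h i l _ hi (blockEquiv_inl_val n ⟨i, hi⟩ l)]
    rw [e, e]
    exact p.adj_getVert_succ (by omega)
  · intro h
    let w : ℕ → Fin n.sqrt → ℤˣ := fun i =>
      if hi : i < n.sqrt then (signsEquiv n ε).1 ⟨i, hi⟩ else fun _ => 1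
    obtain ⟨p, hp, hp'⟩ := exists_walk_getVert (G := G) (n.sqrt - 1) w (by
      intro i hi
      simp only [w, dif_pos (show i < n.sqrt by omega), dif_pos (show i + 1 < n.sqrt by omega)]
      exact h i (by omega))
    refine ⟨_, _, p, by omega, ?_⟩
    intro j l i hj hi
    rw [hp' j (by omega)]
    simp only [w, dif_pos hj]
    rw [signsEquiv_fst]
    congr 1
    apply Fin.ext
    rw [blockEquiv_inl_val, hi]

theorem card_filter_walkSet {n : ℕ} (hn : 1 ≤ n) (G : SimpleGraph (Fin n.sqrt → ℤˣ))
    (q : (Fin n → ℤˣ) → Prop) [DecidablePred q] :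
    ((walkSet n G).filter q).card = ∑ r : Fin (n - n.sqrt * n.sqrt) → ℤˣ,
      ((walkTuples G n.sqrt).filter fun w => q ((signsEquiv n).symm (w, r))).card := by
  classical
  have h1 : (walkSet n G).filter q =
      univ.filter fun ε => (signsEquiv n ε).1 ∈ walkTuples G n.sqrt ∧ q ε := by
    ext ε; simp [mem_walkSet_iff hn]
  have h2 : ∀ r : Fin (n - n.sqrt * n.sqrt) → ℤˣ,
      ((walkTuples G n.sqrt).filter fun w => q ((signsEquiv n).symm (w, r))) =
      univ.filter fun w => w ∈ walkTuples G n.sqrt ∧ q ((signsEquiv n).symm (w, r)) := by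
    intro r; ext w; simp
  simp_rw [h1, h2, Finset.card_filter]
  rw [← Equiv.sum_comp (signsEquiv n).symm, Fintype.sum_prod_type_right]
  simp only [Equiv.apply_symm_apply]

theorem card_walkSet {n : ℕ} (hn : 1 ≤ n) (G : SimpleGraph (Fin n.sqrt → ℤˣ)) :
    (walkSet n G).card = (walkTuples G n.sqrt).card * 2 ^ (n - n.sqrt * n.sqrt) := by
  have h := card_filter_walkSet hn G (fun _ => True)
  simp only [Finset.filter_true, Finset.sum_const, Finset.card_univ, Fintype.card_fun,
    Fintype.card_units_int, Fintype.card_fin, smul_eq_mul] at h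
  rw [h, mul_comm]

theorem sum_signs_mul_eq {n : ℕ} (ε : Fin n → ℤˣ) (v : Fin n → ℝ) :
    ∑ i, ((ε i : ℤ) : ℝ) * v i =
      ∑ j, ∑ l, (((signsEquiv n ε).1 j l : ℤ) : ℝ) * v (blockEquiv n (Sum.inl (j, l))) +
        ∑ i, (((signsEquiv n ε).2 i : ℤ) : ℝ) * v (blockEquiv n (Sum.inr i)) := by
  rw [← Equiv.sum_comp (blockEquiv n), Fintype.sum_sum_type, Fintype.sum_prod_type]
  rfl

theorem smallBallProb_le_one {n : ℕ} (D : Finset (Fin n → ℤˣ)) (v : Fin n → ℝ) (x₀ : ℝ) :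
    smallBallProb D v x₀ ≤ 1 := by
  apply div_le_one_of_le₀ _ (Nat.cast_nonneg _)
  exact_mod_cast Finset.card_filter_le _ _

/-- Condition on the last `n - k²` signs: they only translate `x₀`, and the bound is uniform in
`x₀`. -/
theorem smallBallProb_walkSet_le {n : ℕ} (hn : 1 ≤ n) (G : SimpleGraph (Fin n.sqrt → ℤˣ)) {B : ℝ}
    (hB : 0 ≤ B)
    (h : ∀ v : ℕ → Fin n.sqrt → ℝ, (∀ j l, 1 ≤ v j l) → ∀ x₀ : ℝ,
      (((walkTuples G n.sqrt).filter fun w =>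
        |∑ j : Fin n.sqrt, ∑ l, ((w j l : ℤ) : ℝ) * v j l - x₀| ≤ 1).card : ℝ) ≤
        B * (walkTuples G n.sqrt).card)
    (v : Fin n → ℝ) (hv : ∀ i, 1 ≤ v i) (x₀ : ℝ) : smallBallProb (walkSet n G) v x₀ ≤ B := by
  apply div_le_of_le_mul₀ (Nat.cast_nonneg _) hB
  rw [card_filter_walkSet hn, card_walkSet hn]
  let v' : ℕ → Fin n.sqrt → ℝ := fun j l =>
    if hj : j < n.sqrt then v (blockEquiv n (Sum.inl (⟨j, hj⟩, l))) else 1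
  have hv' : ∀ j l, 1 ≤ v' j l := by
    intro j l
    by_cases hj : j < n.sqrt
    · simpa only [v', dif_pos hj] using hv _
    · simp only [v', dif_neg hj, le_refl]
  have key : ∀ r : Fin (n - n.sqrt * n.sqrt) → ℤˣ, (((walkTuples G n.sqrt).filter fun w =>
      |∑ i, ((((signsEquiv n).symm (w, r)) i : ℤ) : ℝ) * v i - x₀| ≤ 1).card : ℝ) ≤
      B * (walkTuples G n.sqrt).card := by
    intro r
    have := h v' hv' (x₀ - ∑ i, ((r i : ℤ) : ℝ) * v (blockEquiv n (Sum.inr i)))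
    refine le_of_eq_of_le ?_ this
    congr 2
    refine Finset.filter_congr fun w _ => ?_
    rw [sum_signs_mul_eq ((signsEquiv n).symm (w, r)), Equiv.apply_symm_apply]
    simp only [v', Fin.is_lt, dite_true, Fin.eta]
    rw [sub_sub_eq_add_sub]
  push_cast
  refine (Finset.sum_le_sum fun r _ => key r).trans (le_of_eq ?_)
  simp only [Finset.sum_const, Finset.card_univ, Fintype.card_fun, Fintype.card_units_int,
    Fintype.card_fin, nsmul_eq_mul]
  push_cast; ring

theorem IsLittlewoodOffordSet.mono {C₁ C C₁' C' : ℝ} {n : ℕ} {D : Finset (Fin n → ℤˣ)}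
    (h : IsLittlewoodOffordSet C₁ C D) (h1 : C₁ ≤ C₁') (h2 : C ≤ C') :
    IsLittlewoodOffordSet C₁' C' D where
  nonempty := h.nonempty
  card_le := h.card_le.trans (Real.rpow_le_rpow_of_exponent_le (by norm_num)
    (mul_le_mul_of_nonneg_right h1 (Real.sqrt_nonneg _)))
  prob_le v hv x₀ := (h.prob_le v hv x₀).trans
    (div_le_div_of_nonneg_right h2 (Real.sqrt_nonneg _))

theorem natSqrt_le_sqrt (n : ℕ) : (n.sqrt : ℝ) ≤ √n := Real.nat_sqrt_le_real_sqrt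

theorem sqrt_le_two_mul_natSqrt {n : ℕ} (hn : 1 ≤ n) : √(n : ℝ) ≤ 2 * n.sqrt := by
  have h1 : (1 : ℝ) ≤ n.sqrt := by exact_mod_cast Nat.sqrt_pos.2 hn
  have h2 : √(n : ℝ) ≤ n.sqrt + 1 := Real.real_sqrt_le_nat_sqrt_succ
  linarith

/-- The constant in the Littlewood–Offord bound for expanders with spectral bound `lam`. -/
noncomputable def walkConstant (lam : ℝ) : ℝ :=
  2 * (2 * (24 / (1 - lam ^ 2) ^ 2 + 6 * √(24 / (1 - lam ^ 2) ^ 2)))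

/-- With `k = ⌊√n⌋`, the exponent `3 + d` counts `2ᵏ` starting points, at most `2 ^ (d k)`
continuations and at most `2 ^ (2k)` remainders. -/
theorem isLittlewoodOffordSet_walkSet {n : ℕ} (hn : 1 ≤ n) {G : SimpleGraph (Fin n.sqrt → ℤˣ)}
    {d : ℕ} {lam : ℝ} (hG : IsSpectralExpander G d lam) (hlam : lam < 1) :
    IsLittlewoodOffordSet (3 + d) (3 + walkConstant lam) (walkSet n G) where
  nonempty := by
    rw [← Finset.card_pos, card_walkSet hn]
    obtain ⟨m, hm⟩ := Nat.exists_eq_succ_of_ne_zero (Nat.sqrt_pos.2 hn).ne'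
    have hd := Nat.pos_of_ne_zero (hG.degree_ne_zero hlam)
    -- `n.sqrt` is also the word length in the vertex type, so only the number of vertices is
    -- generalised.
    have : ∀ L, L = m + 1 → 0 < (walkTuples G L).card := by
      rintro L rfl
      rw [card_walkTuples hG hlam]
      exact Nat.mul_pos Fintype.card_pos (pow_pos hd _)
    exact Nat.mul_pos (this _ hm) (by positivity)
  card_le := by
    obtain ⟨m, hm⟩ := Nat.exists_eq_succ_of_ne_zero (Nat.sqrt_pos.2 hn).ne'
    have h1 : ∀ L, L = m + 1 → (walkTuples G L).card ≤ 2 ^ n.sqrt * 2 ^ (d * n.sqrt) := by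
      rintro L rfl
      rw [card_walkTuples hG hlam, Fintype.card_fun, Fintype.card_units_int, Fintype.card_fin,
        pow_mul]
      refine Nat.mul_le_mul_left _ ((Nat.pow_le_pow_left Nat.lt_two_pow_self.le m).trans
        (Nat.pow_le_pow_right (by positivity) (by omega)))
    have h2 : n - n.sqrt * n.sqrt ≤ 2 * n.sqrt := by
      have := Nat.sqrt_le_add n; omega
    have h3 : (walkSet n G).card ≤ 2 ^ ((3 + d) * n.sqrt) := by
      rw [card_walkSet hn]
      refine (Nat.mul_le_mul (h1 _ hm) (Nat.pow_le_pow_right (by norm_num) h2)).trans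
        (le_of_eq ?_)
      rw [← pow_add, ← pow_add]; congr 1; ring
    calc ((walkSet n G).card : ℝ) ≤ (2 : ℝ) ^ ((3 + d) * n.sqrt) := by exact_mod_cast h3
      _ = (2 : ℝ) ^ (((3 + d : ℕ) : ℝ) * n.sqrt) := by
        rw [← Real.rpow_natCast]; push_cast; rfl
      _ ≤ _ := by
        apply Real.rpow_le_rpow_of_exponent_le (by norm_num)
        push_cast
        exact mul_le_mul_of_nonneg_left (natSqrt_le_sqrt n) (by positivity)
  prob_le v hv x₀ := by
    have hk : 0 < n.sqrt := Nat.sqrt_pos.2 hn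
    have hn' : (0 : ℝ) < √n := Real.sqrt_pos.2 (by exact_mod_cast hn)
    have hC : 0 ≤ walkConstant lam := by unfold walkConstant; positivity
    -- At most two vertices may leave no interior phase; then `√n ≤ 3` and the bound is trivial.
    rcases le_or_gt n.sqrt 2 with h2 | h2
    · refine (smallBallProb_le_one _ _ _).trans ((one_le_div hn').2 ?_)
      have h3 : √(n : ℝ) ≤ n.sqrt + 1 := Real.real_sqrt_le_nat_sqrt_succ
      have h4 : (n.sqrt : ℝ) ≤ 2 := by exact_mod_cast h2
      linarith
    · obtain ⟨m, hm⟩ : ∃ m, n.sqrt = m + 2 := ⟨n.sqrt - 2, by omega⟩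
      have hm0 : 0 < m := by omega
      set γ := (1 - lam ^ 2) ^ 2 with hγdef
      have hγ : 0 < γ := by
        have := hG.nonneg
        have : 0 < 1 - lam ^ 2 := by nlinarith
        positivity
      have hk' : (0 : ℝ) < n.sqrt := by exact_mod_cast hk
      have hm' : (0 : ℝ) < m := by exact_mod_cast hm0
      -- There are `m = k - 2` interior phases, and `k - 2 ≥ k/3` for `k ≥ 3`.
      have hmk : (n.sqrt : ℝ) / 3 ≤ m := by
        rw [div_le_iff₀ (by norm_num)]
        exact_mod_cast (by omega : n.sqrt ≤ m * 3)
      have e1 : 8 / (γ * m) ≤ 24 / γ / n.sqrt := by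
        rw [div_div, div_le_div_iff₀ (by positivity) (by positivity)]
        nlinarith
      have e2 : 6 / √(γ * m * n.sqrt / 8) ≤ 6 * √(24 / γ) / n.sqrt := by
        have : γ / 24 * (n.sqrt : ℝ) ^ 2 ≤ γ * m * n.sqrt / 8 := by
          have := mul_le_mul_of_nonneg_left hmk (show 0 ≤ γ * n.sqrt / 8 by positivity)
          nlinarith
        have h5 := Real.sqrt_le_sqrt this
        rw [Real.sqrt_mul (by positivity), Real.sqrt_sq hk'.le] at h5
        calc 6 / √(γ * m * n.sqrt / 8) ≤ 6 / (√(γ / 24) * n.sqrt) := by gcongr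
          _ = _ := by
            rw [← inv_div γ 24, Real.sqrt_inv]; field_simp
      refine (smallBallProb_walkSet_le hn G (B := 2 * (8 / (γ * m) + 6 / √(γ * m * n.sqrt / 8)))
        (by positivity) ?_ v hv x₀).trans ?_
      · intro v hv x₀
        have : ∀ L (hL : L = m + 2), (((walkTuples G L).filter fun w =>
            |∑ j : Fin L, ∑ l, ((w j l : ℤ) : ℝ) * v j l - x₀| ≤ 1).card : ℝ) ≤
            2 * (8 / (γ * m) + 6 / √(γ * m * n.sqrt / 8)) * (walkTuples G L).card := by
          rintro L rfl
          refine (card_walkTuples_filter_le hG hlam hm0 hk v hv x₀).trans (le_of_eq ?_)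
          rw [← hγdef]; ring
        exact this _ hm
      · rw [le_div_iff₀ hn']
        calc 2 * (8 / (γ * m) + 6 / √(γ * m * n.sqrt / 8)) * √n
            ≤ 2 * (24 / γ / n.sqrt + 6 * √(24 / γ) / n.sqrt) * (2 * n.sqrt) := by
              gcongr
              exact sqrt_le_two_mul_natSqrt hn
          _ = walkConstant lam := by
              rw [walkConstant, ← hγdef]; field_simp
          _ ≤ _ := by linarith

/-- For `k ≤ 4` the torus is a point, and changing the first letter from `-1` to `1` is the move `j
= 1`. One edge suffices for walks of every length, going back and forth. -/
theorem exists_adj_explicitGraph {k : ℕ} (hk : 1 ≤ k) (hk' : k ≤ 4) :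
    ∃ u v, (explicitGraph k).Adj u v := by
  refine ⟨fun _ => -1, Function.update (fun _ => -1) ⟨0, hk⟩ 1, ?_⟩
  rw [explicitGraph, SimpleGraph.fromRel_adj]
  refine ⟨fun h => ?_, Or.inl ⟨1, le_rfl, by norm_num, ?_, ?_⟩⟩
  · have := congrFun h ⟨0, hk⟩
    simp at this
  · interval_cases k <;> decide +revert
  · interval_cases k <;> decide +revert

theorem nonempty_explicitSet {n : ℕ} (hn : 1 ≤ n) (h : n.sqrt ≤ 4) : (explicitSet n).Nonempty := by
  obtain ⟨u, v, huv⟩ := exists_adj_explicitGraph (Nat.sqrt_pos.2 hn) h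
  rw [← Finset.card_pos, explicitSet, card_walkSet hn]
  refine Nat.mul_pos (Finset.card_pos.2 ⟨fun j => if Even (j : ℕ) then u else v, ?_⟩)
    (by positivity)
  simp only [walkTuples, mem_filter, mem_univ, true_and]
  intro j _
  by_cases hj : Even j
  · simpa [hj, Nat.even_add_one] using huv
  · simpa [hj, Nat.even_add_one] using huv.symm

theorem isLittlewoodOffordSet_of_sqrt_le {n : ℕ} (hn : 1 ≤ n) {C : ℝ} (h : √(n : ℝ) ≤ C)
    {D : Finset (Fin n → ℤˣ)} (hD : D.Nonempty) : IsLittlewoodOffordSet C C D where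
  nonempty := hD
  card_le := by
    have h1 : D.card ≤ 2 ^ n := by
      refine (Finset.card_le_univ D).trans (le_of_eq ?_)
      rw [Fintype.card_fun, Fintype.card_units_int, Fintype.card_fin]
    calc (D.card : ℝ) ≤ (2 : ℝ) ^ n := by exact_mod_cast h1
      _ = (2 : ℝ) ^ (√(n : ℝ) * √(n : ℝ)) := by
        rw [Real.mul_self_sqrt (Nat.cast_nonneg n), Real.rpow_natCast]
      _ ≤ _ := Real.rpow_le_rpow_of_exponent_le (by norm_num)
        (mul_le_mul_of_nonneg_right h (Real.sqrt_nonneg _))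
  prob_le v _ x₀ := (smallBallProb_le_one _ _ _).trans
    ((one_le_div (Real.sqrt_pos.2 (by exact_mod_cast hn))).2 h)

end Splitting

theorem theorem3 :
    -- the explicit sets, built from walks on an explicit expander family of degree 31
    (∃ lam C₁ C : ℝ, lam < 1 ∧
      (∀ k : ℕ, 5 ≤ k → IsSpectralExpander (explicitGraph k) 31 lam) ∧
      ∀ n : ℕ, 1 ≤ n → IsLittlewoodOffordSet C₁ C (explicitSet n)) ∧
    -- the same construction from an arbitrary expander of constant degree
    (∀ (d : ℕ) (lam : ℝ), lam < 1 → ∃ C₁ C : ℝ, ∀ n : ℕ, 1 ≤ n →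
      ∀ G : SimpleGraph (Fin n.sqrt → ℤˣ), IsSpectralExpander G d lam →
        IsLittlewoodOffordSet C₁ C (walkSet n G)) := by
  constructor
  · have hlam : √((961 - 1 / 13636) / 961 : ℝ) < 1 := by
      rw [Real.sqrt_lt' one_pos]; norm_num
    have hC : 0 ≤ walkConstant (√((961 - 1 / 13636) / 961)) := by unfold walkConstant; positivity
    refine ⟨_, 3 + (31 : ℕ), 5 + walkConstant (√((961 - 1 / 13636) / 961)), hlam,
      fun k hk => isSpectralExpander_explicitGraph hk, fun n hn => ?_⟩
    rcases le_or_gt 5 n.sqrt with h | h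
    · exact (isLittlewoodOffordSet_walkSet hn (isSpectralExpander_explicitGraph h) hlam).mono le_rfl
        (by linarith)
    -- If `⌊√n⌋ ≤ 4`, no expansion is available, but `√n ≤ 5` makes both bounds trivial for a
    -- nonempty set.
    · refine (isLittlewoodOffordSet_of_sqrt_le hn (C := 5) ?_
        (nonempty_explicitSet hn (by omega))).mono (by norm_num) (by linarith)
      have h1 : √(n : ℝ) ≤ n.sqrt + 1 := Real.real_sqrt_le_nat_sqrt_succ
      have h2 : (n.sqrt : ℝ) ≤ 4 := by exact_mod_cast (by omega : n.sqrt ≤ 4)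
      linarith
  · intro d lam hlam
    exact ⟨3 + d, 3 + walkConstant lam, fun n hn G hG => isLittlewoodOffordSet_walkSet hn hG hlam⟩
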